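/- Let $(M,g,J)$ be a complete connected Kähler manifold of real dimension $2n\ge 4$ with Levi-Civita connection $\nabla$, and let $\mathcal F$ be a foliation of $M$ by complex curves: its tangent distribution $\mathcal D\subset TM$ is smooth, involutive, of real rank $2$, and $J\mathcal D=\mathcal D$. Put $\mathcal E=\mathcal D^{\perp}$. Assume that $\mathcal F$ is * totally geodesic: $\nabla_XY\in\Gamma(\mathcal D)$ for all local sections $X,Y$ of $\mathcal D$; * holomorphic: $(L_XJ)(TM)\subset\mathcal D$ for every local section $X$ of $\mathcal D$; * homothetic: there is a smooth closed one-form $\alpha$ on $M$, vanishing on $\mathcal E$, such that $L_Vg=\alpha(V)\,g$ on $\mathcal E$ for every local section $V$ of $\mathcal D$ (such an $\alpha$ is unique). Let $U=\{x\in M:\alpha_x\neq 0\}$ and $K=M\setminus U$, and assume $U\neq\emptyset$. For a local section $X$ of $\mathcal D$ let $\operatorname{div}_{\mathcal E}X$ be the trace over $\mathcal E$ of $(v,w)\mapsto g(\nabla_vX,w)$. The principal section over an open set $W\subset U$ is the smooth unit section $\xi$ of $\mathcal D|_W$ with $\operatorname{div}_{\mathcal E}(J\xi)=0$ and $\operatorname{div}_{\mathcal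 E}\xi>0$. A local special Killing field on an open set $W\subset U$ is a Killing field on $W$ of the form $e^{F}J\xi$, where $\xi$ is the principal section over $W$ and $F\in C^\infty(W)$ satisfies $dF=-p^*\,g(\xi,\cdot)$ with $p^*=g(\nabla_{J\xi}J\xi,\xi)$. A set is called geodesically convex if any two of its points are joined by a unique minimizing geodesic segment of $M$ and this segment lies in the set. Lemma 6.2. For every geodesically convex open set $V\subset M$ there are a smooth vector field $X$ on $V$ and a function $\tau\in C^\infty(V)$ such that $X=J\nabla\tau$ on $V$, $X$ is a Killing field, $X$ is holomorphic ($L_XJ=0$), $X=0$ on $V\cap K$, and for every geodesically convex open set $W\subset V\cap U$ the restriction $X|_W$ is a local special Killing field on $W$. -/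

import Mathlib

open Bundle Manifold ContDiff VectorField

namespace HomotheticKahler

noncomputable section

set_option linter.unusedSectionVars false

variable {E : Type*} [NormedAddCommGroup E] [NormedSpace ℝ E] [FiniteDimensional ℝ E]
  {M : Type*} [TopologicalSpace M] [ChartedSpace E M] [IsManifold 𝓘(ℝ, E) ∞ M]
  [RiemannianBundle (fun x : M => TangentSpace 𝓘(ℝ, E) x)]
  [IsContMDiffRiemannianBundle 𝓘(ℝ, E) ∞ E (fun x : M => TangentSpace 𝓘(ℝ, E) x)]

/-! ### The Levi-Civita connection, built from the Koszul formula -/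

/-- Right-hand side of the Koszul formula: the value that `g(∇_X Y, Z)` must have at `x`. -/
def koszul (X Y Z : Π x : M, TangentSpace 𝓘(ℝ, E) x) (x : M) : ℝ :=
  (1 / 2 : ℝ) *
    (mvfderiv 𝓘(ℝ, E) (fun y => inner ℝ (Y y) (Z y)) x (X x)
      + mvfderiv 𝓘(ℝ, E) (fun y => inner ℝ (Z y) (X y)) x (Y x)
      - mvfderiv 𝓘(ℝ, E) (fun y => inner ℝ (X y) (Y y)) x (Z x)
      + inner ℝ (mlieBracket 𝓘(ℝ, E) X Y x) (Z x)
      - inner ℝ (mlieBracket 𝓘(ℝ, E) Y Z x) (X x)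
      - inner ℝ (mlieBracket 𝓘(ℝ, E) X Z x) (Y x))

theorem mdiffAt_inner {Y Z : Π x : M, TangentSpace 𝓘(ℝ, E) x} {x : M}
    (hY : MDiffAt (T% Y) x) (hZ : MDiffAt (T% Z) x) :
    MDiffAt (fun y : M => (inner ℝ (Y y) (Z y) : ℝ)) x :=
  MDifferentiableAt.inner_bundle (E := fun x : M => TangentSpace 𝓘(ℝ, E) x) hY hZ

theorem koszul_tensorial_left {Y Z : Π x : M, TangentSpace 𝓘(ℝ, E) x} {x : M}
    (hY : MDiffAt (T% Y) x) (hZ : MDiffAt (T% Z) x) :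
    TensorialAt 𝓘(ℝ, E) E (fun X : Π x : M, TangentSpace 𝓘(ℝ, E) x => koszul X Y Z x) x where
  smul hf hX := by
    have h1 := mvfderiv_fun_mul hf (mdiffAt_inner hZ hX)
    have h2 := mvfderiv_fun_mul hf (mdiffAt_inner hX hY)
    simp [koszul, inner_smul_left, inner_smul_right, h1, h2, mlieBracket_smul_left hf hX,
      inner_add_left]
    rw [real_inner_comm (Z x)]
    ring
  add hX hX' := by
    have h1 := mvfderiv_fun_add (mdiffAt_inner hZ hX) (mdiffAt_inner hZ hX')
    have h2 := mvfderiv_fun_add (mdiffAt_inner hX hY) (mdiffAt_inner hX' hY)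
    simp [koszul, inner_add_left, inner_add_right, h1, h2, mlieBracket_add_left hX hX']
    ring

theorem koszul_tensorial_right {X Y : Π x : M, TangentSpace 𝓘(ℝ, E) x} {x : M}
    (hX : MDiffAt (T% X) x) (hY : MDiffAt (T% Y) x) :
    TensorialAt 𝓘(ℝ, E) E (fun Z : Π x : M, TangentSpace 𝓘(ℝ, E) x => koszul X Y Z x) x where
  smul {f Z} hf hZ := by
    have h1 := mvfderiv_fun_mul hf (mdiffAt_inner hY hZ)
    have h2 := mvfderiv_fun_mul hf (mdiffAt_inner hZ hX)
    simp [koszul, inner_smul_left, inner_smul_right, h1, h2, mlieBracket_smul_right hf hZ,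
      inner_add_left]
    rw [real_inner_comm (Z x) (Y x)]
    ring
  add hZ hZ' := by
    have h1 := mvfderiv_fun_add (mdiffAt_inner hY hZ) (mdiffAt_inner hY hZ')
    have h2 := mvfderiv_fun_add (mdiffAt_inner hZ hX) (mdiffAt_inner hZ' hX)
    simp [koszul, inner_add_left, inner_add_right, h1, h2, mlieBracket_add_right hZ hZ']
    ring

theorem koszul_add_mid {X Y Y' Z : Π x : M, TangentSpace 𝓘(ℝ, E) x} {x : M}
    (hX : MDiffAt (T% X) x) (hY : MDiffAt (T% Y) x) (hY' : MDiffAt (T% Y') x)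
    (hZ : MDiffAt (T% Z) x) :
    koszul X (Y + Y') Z x = koszul X Y Z x + koszul X Y' Z x := by
  have h1 := mvfderiv_fun_add (mdiffAt_inner hY hZ) (mdiffAt_inner hY' hZ)
  have h2 := mvfderiv_fun_add (mdiffAt_inner hX hY) (mdiffAt_inner hX hY')
  simp [koszul, inner_add_left, inner_add_right, h1, h2, mlieBracket_add_right hY hY',
    mlieBracket_add_left hY hY']
  ring

theorem koszul_smul_mid {X Y Z : Π x : M, TangentSpace 𝓘(ℝ, E) x} {f : M → ℝ} {x : M}
    (hX : MDiffAt (T% X) x) (hY : MDiffAt (T% Y) x) (hf : MDiffAt f x)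
    (hZ : MDiffAt (T% Z) x) :
    koszul X (f • Y) Z x
      = f x * koszul X Y Z x + mvfderiv 𝓘(ℝ, E) f x (X x) * inner ℝ (Y x) (Z x) := by
  have h1 := mvfderiv_fun_mul hf (mdiffAt_inner hY hZ)
  have h2 := mvfderiv_fun_mul hf (mdiffAt_inner hX hY)
  simp [koszul, inner_smul_left, inner_smul_right, h1, h2, mlieBracket_smul_right hf hY,
    mlieBracket_smul_left hf hY, inner_add_left]
  rw [real_inner_comm (Y x) (X x)]
  ring

/-- The tangent vector that is dual to a covector with respect to the metric
(see `inner_sharp`). -/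
def sharp {x : M} (θ : TangentSpace 𝓘(ℝ, E) x →L[ℝ] ℝ) : TangentSpace 𝓘(ℝ, E) x :=
  haveI : FiniteDimensional ℝ (TangentSpace 𝓘(ℝ, E) x) := inferInstanceAs (FiniteDimensional ℝ E)
  ∑ i, θ (stdOrthonormalBasis ℝ (TangentSpace 𝓘(ℝ, E) x) i) •
    stdOrthonormalBasis ℝ (TangentSpace 𝓘(ℝ, E) x) i

theorem inner_sharp {x : M} (θ : TangentSpace 𝓘(ℝ, E) x →L[ℝ] ℝ) (v : TangentSpace 𝓘(ℝ, E) x) :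
    inner ℝ (sharp θ) v = θ v := by
  have : FiniteDimensional ℝ (TangentSpace 𝓘(ℝ, E) x) := inferInstanceAs (FiniteDimensional ℝ E)
  conv_rhs => rw [← (stdOrthonormalBasis ℝ (TangentSpace 𝓘(ℝ, E) x)).sum_repr' v]
  simp [sharp, sum_inner, inner_smul_left, mul_comm]

open Classical in
/-- The bilinear form `(u, w) ↦ g(∇_u Y, w)` on the tangent space at `x`. -/
def koszulForm (Y : Π x : M, TangentSpace 𝓘(ℝ, E) x) (x : M) :
    TangentSpace 𝓘(ℝ, E) x →L[ℝ] TangentSpace 𝓘(ℝ, E) x →L[ℝ] ℝ :=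
  if hY : MDiffAt (T% Y) x then
    TensorialAt.mkHom₂ (I := 𝓘(ℝ, E)) (F := E) (F' := E) (fun X Z => koszul X Y Z x) x
      (fun _ hZ => koszul_tensorial_left hY hZ) (fun _ hX => koszul_tensorial_right hX hY)
  else 0

theorem koszulForm_apply {X Y Z : Π x : M, TangentSpace 𝓘(ℝ, E) x} {x : M}
    (hX : MDiffAt (T% X) x) (hY : MDiffAt (T% Y) x) (hZ : MDiffAt (T% Z) x) :
    koszulForm Y x (X x) (Z x) = koszul X Y Z x := by
  rw [koszulForm, dif_pos hY]
  exact TensorialAt.mkHom₂_apply (I := 𝓘(ℝ, E)) (F := E) (F' := E)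
    (fun _ hZ => koszul_tensorial_left hY hZ) (fun _ hX => koszul_tensorial_right hX hY) hX hZ

/-- The covariant derivative `u ↦ ∇_u Y` at `x`. -/
def nabla (Y : Π x : M, TangentSpace 𝓘(ℝ, E) x) (x : M) :
    TangentSpace 𝓘(ℝ, E) x →L[ℝ] TangentSpace 𝓘(ℝ, E) x :=
  haveI : FiniteDimensional ℝ (TangentSpace 𝓘(ℝ, E) x) := inferInstanceAs (FiniteDimensional ℝ E)
  LinearMap.toContinuousLinearMap
    { toFun := fun u => sharp (koszulForm Y x u)
      map_add' := fun u v => ext_inner_right ℝ fun w => by simp [inner_sharp, inner_add_left]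
      map_smul' := fun c u => ext_inner_right ℝ fun w => by simp [inner_sharp, inner_smul_left] }

theorem inner_nabla {X Y Z : Π x : M, TangentSpace 𝓘(ℝ, E) x} {x : M}
    (hX : MDiffAt (T% X) x) (hY : MDiffAt (T% Y) x) (hZ : MDiffAt (T% Z) x) :
    inner ℝ (nabla Y x (X x)) (Z x) = koszul X Y Z x := by
  rw [← koszulForm_apply hX hY hZ, ← inner_sharp]
  rfl

/-- The Levi-Civita connection of the Riemannian manifold `M`; `leviCivita Y x u` is `∇_u Y`.
It is torsion-free and metric, see `leviCivita_torsion` and `leviCivita_metric`. -/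
def leviCivita : CovariantDerivative 𝓘(ℝ, E) E (fun x : M => TangentSpace 𝓘(ℝ, E) x) where
  toFun := nabla
  isCovariantDerivativeOnUniv :=
    { add := fun {Y Y' x} hY hY' _ => by
        ext1 u
        refine ext_inner_right ℝ fun w => ?_
        have hu := FiberBundle.mdifferentiableAt_extend 𝓘(ℝ, E) E u
        have hw := FiberBundle.mdifferentiableAt_extend 𝓘(ℝ, E) E w
        have h1 := inner_nabla hu (mdifferentiableAt_add_section hY hY') hw
        have h2 := inner_nabla hu hY hw
        have h3 := inner_nabla hu hY' hw
        have h4 := koszul_add_mid hu hY hY' hw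
        simp only [FiberBundle.extend_apply_self] at h1 h2 h3
        simp [inner_add_left, h1, h2, h3, h4]
      leibniz := fun {Y f x} hY hf _ => by
        ext1 u
        refine ext_inner_right ℝ fun w => ?_
        have hu := FiberBundle.mdifferentiableAt_extend 𝓘(ℝ, E) E u
        have hw := FiberBundle.mdifferentiableAt_extend 𝓘(ℝ, E) E w
        have h1 := inner_nabla hu (hf.smul_section hY) hw
        have h2 := inner_nabla hu hY hw
        have h4 := koszul_smul_mid hu hY hf hw
        simp only [FiberBundle.extend_apply_self] at h1 h2 h4
        simp [inner_add_left, inner_smul_left, h1, h2, h4] }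

theorem leviCivita_torsion : (leviCivita (E := E) (M := M)).torsion = 0 := by
  rw [CovariantDerivative.torsion_eq_zero_iff]
  intro X Y x hX hY
  refine ext_inner_right ℝ fun w => ?_
  have hw := FiberBundle.mdifferentiableAt_extend 𝓘(ℝ, E) E w
  have h1 := inner_nabla hX hY hw
  have h2 := inner_nabla hY hX hw
  simp only [FiberBundle.extend_apply_self] at h1 h2
  change inner ℝ (nabla Y x (X x) - nabla X x (Y x)) w = _
  rw [inner_sub_left, h1, h2]
  simp only [koszul, FiberBundle.extend_apply_self]
  rw [mlieBracket_swap_apply (V := Y) (W := X)]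
  simp only [real_inner_comm, inner_neg_left]
  ring

theorem leviCivita_metric {X Y Z : Π x : M, TangentSpace 𝓘(ℝ, E) x} {x : M}
    (hX : MDiffAt (T% X) x) (hY : MDiffAt (T% Y) x) (hZ : MDiffAt (T% Z) x) :
    mvfderiv 𝓘(ℝ, E) (fun y => (inner ℝ (Y y) (Z y) : ℝ)) x (X x)
      = inner ℝ (leviCivita Y x (X x)) (Z x) + inner ℝ (Y x) (leviCivita Z x (X x)) := by
  have h1 := inner_nabla hX hY hZ
  have h2 := inner_nabla hX hZ hY
  change _ = inner ℝ (nabla Y x (X x)) (Z x) + inner ℝ (Y x) (nabla Z x (X x))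
  rw [real_inner_comm (nabla Z x (X x)) (Y x), h1, h2]
  simp only [koszul]
  rw [mlieBracket_swap_apply (V := Z) (W := Y)]
  simp only [real_inner_comm, inner_neg_left]
  ring

/-! ### Kähler structures, gradients, Killing and holomorphic fields -/

/-- `J` is a smooth, orthogonal, parallel almost complex structure, i.e. `(M, g, J)` is Kähler. -/
structure IsKahler (J : Π x : M, TangentSpace 𝓘(ℝ, E) x →L[ℝ] TangentSpace 𝓘(ℝ, E) x) :
    Prop where
  smooth : ContMDiff 𝓘(ℝ, E) (𝓘(ℝ, E).prod 𝓘(ℝ, E →L[ℝ] E)) ∞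
    (fun x => TotalSpace.mk' (E →L[ℝ] E)
      (E := fun x : M => TangentSpace 𝓘(ℝ, E) x →L[ℝ] TangentSpace 𝓘(ℝ, E) x) x (J x))
  sq : ∀ (x : M) (v : TangentSpace 𝓘(ℝ, E) x), J x (J x v) = -v
  isometry : ∀ (x : M) (v w : TangentSpace 𝓘(ℝ, E) x),
    (inner ℝ (J x v) (J x w) : ℝ) = inner ℝ v w
  parallel : ∀ (Y : Π x : M, TangentSpace 𝓘(ℝ, E) x) (x : M), MDiffAt (T% Y) x →
    ∀ u : TangentSpace 𝓘(ℝ, E) x,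
      leviCivita (fun y => J y (Y y)) x u = J x (leviCivita Y x u)

/-- The gradient `∇τ` of a function. -/
def gradient (τ : M → ℝ) (x : M) : TangentSpace 𝓘(ℝ, E) x :=
  sharp (mvfderiv 𝓘(ℝ, E) τ x)

/-- The Lie derivative of the metric,
`(L_X g)(Y, Z) = X(g(Y, Z)) - g([X, Y], Z) - g(Y, [X, Z])`. -/
def lieDerivMetric (X Y Z : Π x : M, TangentSpace 𝓘(ℝ, E) x) (x : M) : ℝ :=
  mvfderiv 𝓘(ℝ, E) (fun y => (inner ℝ (Y y) (Z y) : ℝ)) x (X x)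
    - inner ℝ (mlieBracket 𝓘(ℝ, E) X Y x) (Z x)
    - inner ℝ (Y x) (mlieBracket 𝓘(ℝ, E) X Z x)

/-- The vector field `(L_X J) Y = [X, J Y] - J [X, Y]`. -/
def lieDerivJ (J : Π x : M, TangentSpace 𝓘(ℝ, E) x →L[ℝ] TangentSpace 𝓘(ℝ, E) x)
    (X Y : Π x : M, TangentSpace 𝓘(ℝ, E) x) (x : M) : TangentSpace 𝓘(ℝ, E) x :=
  mlieBracket 𝓘(ℝ, E) X (fun y => J y (Y y)) x - J x (mlieBracket 𝓘(ℝ, E) X Y x)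

/-- `X` is a smooth vector field on the open set `O`. -/
def IsSmoothFieldOn (O : Set M) (X : Π x : M, TangentSpace 𝓘(ℝ, E) x) : Prop :=
  CMDiff[O] ∞ (T% X)

/-- `X` is a Killing field on the open set `O`: it is smooth on `O` and `L_X g = 0` there. -/
def IsKillingOn (O : Set M) (X : Π x : M, TangentSpace 𝓘(ℝ, E) x) : Prop :=
  IsSmoothFieldOn O X ∧
  ∀ x ∈ O, ∀ Y Z : Π x : M, TangentSpace 𝓘(ℝ, E) x,
    MDiffAt (T% Y) x → MDiffAt (T% Z) x → lieDerivMetric X Y Z x = 0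

/-- `X` is a (real) holomorphic field on the open set `O`: it is smooth on `O` and
`L_X J = 0` there. -/
def IsHolomorphicOn (J : Π x : M, TangentSpace 𝓘(ℝ, E) x →L[ℝ] TangentSpace 𝓘(ℝ, E) x)
    (O : Set M) (X : Π x : M, TangentSpace 𝓘(ℝ, E) x) : Prop :=
  IsSmoothFieldOn O X ∧
  ∀ x ∈ O, ∀ Y : Π x : M, TangentSpace 𝓘(ℝ, E) x, MDiffAt (T% Y) x → lieDerivJ J X Y x = 0

/-! ### Foliations, given by their tangent distributions -/

/-- `X` is a local section of the distribution `D`, smooth on the open set `O`. -/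
def IsSectionOn (D : Π x : M, Submodule ℝ (TangentSpace 𝓘(ℝ, E) x)) (O : Set M)
    (X : Π x : M, TangentSpace 𝓘(ℝ, E) x) : Prop :=
  IsSmoothFieldOn O X ∧ ∀ x ∈ O, X x ∈ D x

/-- `D` is the tangent distribution of a complex foliation by (complex) curves: a smooth
distribution of real rank two that is `J`-invariant and involutive. -/
structure IsComplexFoliation
    (J : Π x : M, TangentSpace 𝓘(ℝ, E) x →L[ℝ] TangentSpace 𝓘(ℝ, E) x)
    (D : Π x : M, Submodule ℝ (TangentSpace 𝓘(ℝ, E) x)) : Prop where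
  rank_two : ∀ x : M, Module.finrank ℝ (D x) = 2
  smooth : ∀ x : M, ∃ O : Set M, IsOpen O ∧ x ∈ O ∧
    ∃ X Y : Π x : M, TangentSpace 𝓘(ℝ, E) x, IsSmoothFieldOn O X ∧ IsSmoothFieldOn O Y ∧
      ∀ y ∈ O, D y = Submodule.span ℝ {X y, Y y}
  complex : ∀ (x : M), ∀ v ∈ D x, J x v ∈ D x
  involutive : ∀ O : Set M, IsOpen O → ∀ X Y : Π x : M, TangentSpace 𝓘(ℝ, E) x,
    IsSectionOn D O X → IsSectionOn D O Y → ∀ x ∈ O, mlieBracket 𝓘(ℝ, E) X Y x ∈ D x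

/-- The leaves of the foliation are totally geodesic: `∇_X Y` is tangent to the leaves
whenever `X` and `Y` are. -/
def IsTotallyGeodesic (D : Π x : M, Submodule ℝ (TangentSpace 𝓘(ℝ, E) x)) : Prop :=
  ∀ O : Set M, IsOpen O → ∀ X Y : Π x : M, TangentSpace 𝓘(ℝ, E) x,
    IsSectionOn D O X → IsSectionOn D O Y → ∀ x ∈ O, leviCivita Y x (X x) ∈ D x

/-- The foliation is holomorphic: `(L_X J)(TM)` lies in `D` for every local section `X` of `D`. -/
def IsHolomorphicFoliation
    (J : Π x : M, TangentSpace 𝓘(ℝ, E) x →L[ℝ] TangentSpace 𝓘(ℝ, E) x)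
    (D : Π x : M, Submodule ℝ (TangentSpace 𝓘(ℝ, E) x)) : Prop :=
  ∀ O : Set M, IsOpen O → ∀ X : Π x : M, TangentSpace 𝓘(ℝ, E) x, IsSectionOn D O X →
    ∀ x ∈ O, ∀ Y : Π x : M, TangentSpace 𝓘(ℝ, E) x, MDiffAt (T% Y) x → lieDerivJ J X Y x ∈ D x

/-- The foliation with tangent distribution `D` is homothetic, with one-form `α`: the smooth
one-form `α` vanishes on the orthogonal complement of `D`, is closed, and
`L_V g = α(V) g` holds on that complement for every local section `V` of `D`.
(These conditions determine `α`.) -/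
structure IsHomotheticFoliation (D : Π x : M, Submodule ℝ (TangentSpace 𝓘(ℝ, E) x))
    (α : Π x : M, TangentSpace 𝓘(ℝ, E) x →L[ℝ] ℝ) : Prop where
  smooth : ContMDiff 𝓘(ℝ, E) (𝓘(ℝ, E).prod 𝓘(ℝ, E →L[ℝ] ℝ)) ∞
    (fun x => TotalSpace.mk' (E →L[ℝ] ℝ)
      (E := fun x : M => TangentSpace 𝓘(ℝ, E) x →L[ℝ] ℝ) x (α x))
  vanishes : ∀ x : M, ∀ v ∈ (D x)ᗮ, α x v = 0
  conformal : ∀ O : Set M, IsOpen O → ∀ V : Π x : M, TangentSpace 𝓘(ℝ, E) x,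
    IsSectionOn D O V → ∀ x ∈ O, ∀ Y Z : Π x : M, TangentSpace 𝓘(ℝ, E) x,
      MDiffAt (T% Y) x → MDiffAt (T% Z) x → Y x ∈ (D x)ᗮ → Z x ∈ (D x)ᗮ →
      lieDerivMetric V Y Z x = α x (V x) * inner ℝ (Y x) (Z x)
  closed : ∀ (x : M) (X Y : Π x : M, TangentSpace 𝓘(ℝ, E) x),
    MDiffAt (T% X) x → MDiffAt (T% Y) x →
      mvfderiv 𝓘(ℝ, E) (fun y => α y (Y y)) x (X x)
        - mvfderiv 𝓘(ℝ, E) (fun y => α y (X y)) x (Y x)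
        - α x (mlieBracket 𝓘(ℝ, E) X Y x) = 0

/-! ### The principal section and local special Killing fields -/

/-- The partial divergence `div_𝓔 X` at `x`, where `𝓔` is the orthogonal complement of `D`:
the trace over `𝓔` of `(v, w) ↦ g(∇_v X, w)`. -/
def divPerp (D : Π x : M, Submodule ℝ (TangentSpace 𝓘(ℝ, E) x))
    (X : Π x : M, TangentSpace 𝓘(ℝ, E) x) (x : M) : ℝ :=
  haveI : FiniteDimensional ℝ (TangentSpace 𝓘(ℝ, E) x) := inferInstanceAs (FiniteDimensional ℝ E)
  ∑ i, inner ℝ (leviCivita X x (stdOrthonormalBasis ℝ (D x)ᗮ i : (D x)ᗮ))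
    ((stdOrthonormalBasis ℝ (D x)ᗮ i : (D x)ᗮ) : TangentSpace 𝓘(ℝ, E) x)

/-- `ξ` is the principal section of `D` over the open set `O`: the smooth unit section of `D`
with `div_𝓔 (J ξ) = 0` and `div_𝓔 ξ > 0`. -/
structure IsPrincipalSectionOn
    (J : Π x : M, TangentSpace 𝓘(ℝ, E) x →L[ℝ] TangentSpace 𝓘(ℝ, E) x)
    (D : Π x : M, Submodule ℝ (TangentSpace 𝓘(ℝ, E) x)) (O : Set M)
    (ξ : Π x : M, TangentSpace 𝓘(ℝ, E) x) : Prop where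
  isSection : IsSectionOn D O ξ
  unit : ∀ x ∈ O, ‖ξ x‖ = 1
  div_J : ∀ x ∈ O, divPerp D (fun y => J y (ξ y)) x = 0
  div_pos : ∀ x ∈ O, 0 < divPerp D ξ x

/-- `X` is a local special Killing field on the open set `O`: it is a Killing field on `O` of
the form `X = e^F J ξ`, where `ξ` is the principal section and `F` is a smooth function on `O`
with `dF = - p g(ξ, ·)`, `p = g(∇_{Jξ} Jξ, ξ)`. -/
def IsLocalSpecialKillingOn
    (J : Π x : M, TangentSpace 𝓘(ℝ, E) x →L[ℝ] TangentSpace 𝓘(ℝ, E) x)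
    (D : Π x : M, Submodule ℝ (TangentSpace 𝓘(ℝ, E) x)) (O : Set M)
    (X : Π x : M, TangentSpace 𝓘(ℝ, E) x) : Prop :=
  IsKillingOn O X ∧
  ∃ (ξ : Π x : M, TangentSpace 𝓘(ℝ, E) x) (F : M → ℝ),
    IsPrincipalSectionOn J D O ξ ∧ CMDiff[O] ∞ F ∧
    (∀ x ∈ O, ∀ u : TangentSpace 𝓘(ℝ, E) x, mvfderiv 𝓘(ℝ, E) F x u
      = - inner ℝ (leviCivita (fun y => J y (ξ y)) x (J x (ξ x))) (ξ x) * inner ℝ (ξ x) u) ∧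
    ∀ x ∈ O, X x = Real.exp (F x) • J x (ξ x)

end

/-! ### Geodesic convexity -/

/-- `γ`, restricted to `[0, 1]`, is a minimizing geodesic from `p` to `q`, parametrized
proportionally to arc length. On a Riemannian manifold with its Riemannian distance these are
exactly the geodesics from `p` to `q` whose length is the distance of `p` and `q`. -/
def IsMinimizingGeodesic {M : Type*} [MetricSpace M] (γ : ℝ → M) (p q : M) : Prop :=
  γ 0 = p ∧ γ 1 = q ∧
    ∀ s ∈ Set.Icc (0 : ℝ) 1, ∀ t ∈ Set.Icc (0 : ℝ) 1, dist (γ s) (γ t) = |s - t| * dist p q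

/-- `V` is geodesically convex: any two points of `V` are joined by a unique minimizing geodesic
of `M`, and this geodesic lies in `V`. -/
def IsGeodesicallyConvex {M : Type*} [MetricSpace M] (V : Set M) : Prop :=
  ∀ p ∈ V, ∀ q ∈ V, ∃ γ : ℝ → M, IsMinimizingGeodesic γ p q ∧
    (∀ t ∈ Set.Icc (0 : ℝ) 1, γ t ∈ V) ∧
    ∀ γ' : ℝ → M, IsMinimizingGeodesic γ' p q → Set.EqOn γ' γ (Set.Icc 0 1)

end HomotheticKahler

/-! Let `A` be the metric dual of `α`. A geodesically convex open set `V` contracts along its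
minimizing geodesics to a base point (`IsGeodesicallyConvex.contractibleSpace`), so the closed form
`α` has a primitive `φ` on `V` (`exists_primitive`). Take `τ = e^φ` and `X = J∇τ = e^φ J A`. Since
`J` is parallel, `∇X = e^φ J S` with `S = α ⊗ A + ∇A`, and `S` is symmetric because `α` is closed.
Hence `X` is Killing and holomorphic as soon as `S` commutes with `J`.

Where `α ≠ 0`, the fields `A` and `JA` span `D`. The leaves being totally geodesic, `∇A` preserves
`D`, hence also `Dᗮ`, where the homothetic condition makes it `|A|²/2` times the identity. On `D`
the information comes from `d ∘ d = 0` for the one-form `g(JA, ·)`, evaluated on `X, JX, V` with `X`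
in `Dᗮ` and `V` in `D` (`closed_identity`). The `D`-component of `[X, JX]` is `-|X|² JA`, and the
choices `V = A`, `V = JA` give `∇_A A = a A` and `∇_{JA} A = (a + |A|²) JA` (`nabla_diagonal`); real
dimension at least four provides `X ≠ 0`. Adding `α ⊗ A` raises the first eigenvalue to the second,
so `S` is a scalar on `D` and a scalar on `Dᗮ`, and commutes with `J`. Continuity carries this to
the closure of `U`, and `S = 0` on the interior of `K` (`smul_add_nabla_comm`).

On `U` the principal section is `ξ = A/|A|`, and `F = φ + log|A|` gives `e^F Jξ = X`. The
eigenvalues on `D` give `dF = (1 + a/|A|²) α = -p* g(ξ, ·)`. -/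

namespace HomotheticKahler

/-! ### Gluing local primitives -/

/-- The real numbers with the discrete topology. -/
structure DiscreteReal where
  /-- the underlying real number -/
  val : ℝ

instance : TopologicalSpace DiscreteReal := ⊥

instance : DiscreteTopology DiscreteReal := ⟨rfl⟩

/-- The covering space of primitives of a locally exact form: the functions `ψ i` on the open
sets `O i` differ by locally constant functions. -/
noncomputable def primitiveCore {X : Type*} [TopologicalSpace X] (O : X → Set X)
    (hO : ∀ i, IsOpen (O i)) (hmem : ∀ i, i ∈ O i) (ψ : X → X → ℝ)
    (hψ : ∀ i j x, x ∈ O i ∩ O j → ∀ᶠ y in nhds x, ψ i y - ψ j y = ψ i x - ψ j x) :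
    FiberBundleCore X X DiscreteReal where
  baseSet := O
  isOpen_baseSet := hO
  indexAt := id
  mem_baseSet_at := hmem
  coordChange i j x v := ⟨v.val + (ψ i x - ψ j x)⟩
  coordChange_self i x _ v := by simp
  continuousOn_coordChange i j := by
    rintro ⟨x, v⟩ ⟨hx, -⟩
    apply ContinuousAt.continuousWithinAt
    have h1 : ∀ᶠ q : X × DiscreteReal in nhds (x, v),
        ψ i q.1 - ψ j q.1 = ψ i x - ψ j x := (continuousAt_fst (p := (x, v))).eventually (hψ i j x hx)
    have h2 : ∀ᶠ q : X × DiscreteReal in nhds (x, v), q.2 = v := by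
      have : {v} ∈ nhds v := by simp [nhds_discrete]
      exact (continuousAt_snd (p := (x, v))).eventually this
    refine (continuousAt_const (y := (⟨v.val + (ψ i x - ψ j x)⟩ : DiscreteReal))).congr ?_
    filter_upwards [h1, h2] with q hq1 hq2
    simp only [hq1, hq2]
  coordChange_comp i j k x _ v := by
    simp only [DiscreteReal.mk.injEq]
    ring

/-- A global primitive is a section of the covering space of germs of primitives. Simple
connectedness provides it, as a lift of the identity map. -/
theorem exists_primitive_of_locally {X : Type*} [TopologicalSpace X] [SimplyConnectedSpace X]
    [LocallyPathConnectedSpace X] (O : X → Set X)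
    (hO : ∀ i, IsOpen (O i)) (hmem : ∀ i, i ∈ O i) (ψ : X → X → ℝ)
    (hψ : ∀ i j x, x ∈ O i ∩ O j → ∀ᶠ y in nhds x, ψ i y - ψ j y = ψ i x - ψ j x) :
    ∃ φ : X → ℝ, ∀ i, ∀ x ∈ O i, ∀ᶠ y in nhds x, φ y - ψ i y = φ x - ψ i x := by
  let Z := primitiveCore O hO hmem ψ hψ
  have cov : IsCoveringMap (π DiscreteReal Z.Fiber) := FiberBundle.isCoveringMap
  obtain ⟨p⟩ : Nonempty X := inferInstance
  obtain ⟨s, ⟨-, hs⟩, -⟩ := cov.existsUnique_continuousMap_lifts (ContinuousMap.id X) p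
    ⟨p, (⟨0⟩ : DiscreteReal)⟩ rfl
  have hs' : ∀ x, (s x).1 = x := fun x => congrFun hs x
  let c : X → ℝ := fun x => DiscreteReal.val (s x).2
  -- The fibre over `x` is read in the chart with index `x` itself, where the coordinate `c x`
  -- stands for the primitive `ψ x + c x`; hence the value at `x`.
  refine ⟨fun x => c x + ψ x x, fun i x hx => ?_⟩
  have hc : ContinuousAt (fun y => (Z.localTriv i (s y)).2) x := by
    have h1 : ContinuousAt (Z.localTriv i) (s x) := by
      apply (Z.localTriv i).continuousAt
      rw [(Z.localTriv i).mem_source]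
      change (s x).1 ∈ O i
      rwa [hs' x]
    exact continuousAt_snd.comp (h1.comp s.continuous.continuousAt)
  have hv : ∀ y, (Z.localTriv i (s y)).2 = ⟨c y + (ψ y y - ψ i y)⟩ := by
    intro y
    change DiscreteReal.mk (c y + (ψ (s y).1 (s y).1 - ψ i (s y).1)) = _
    rw [hs' y]
  -- A continuous map into the discrete fibre is locally constant.
  have hev : ∀ᶠ y in nhds x, (Z.localTriv i (s y)).2 = (Z.localTriv i (s x)).2 := by
    have : {(Z.localTriv i (s x)).2} ∈ nhds (Z.localTriv i (s x)).2 := by simp [nhds_discrete]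
    exact hc.eventually this
  filter_upwards [hev] with y hy
  rw [hv, hv] at hy
  have hy' : c y + (ψ y y - ψ i y) = c x + (ψ x x - ψ i x) := congrArg DiscreteReal.val hy
  linarith

/-! ### Geodesically convex sets are contractible -/

section Convex

variable {M : Type*} [MetricSpace M]

/-- Upper bounds suffice: the bounds on `[0,s]`, `[s,t]`, `[t,1]` add up to `dist p q`, so by the
triangle inequality none of them is strict. -/
theorem isMinimizingGeodesic_of_le {γ : ℝ → M} {p q : M} (h0 : γ 0 = p) (h1 : γ 1 = q)
    (h : ∀ s t : ℝ, 0 ≤ s → s ≤ t → t ≤ 1 → dist (γ s) (γ t) ≤ (t - s) * dist p q) :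
    IsMinimizingGeodesic γ p q := by
  have key : ∀ s t : ℝ, 0 ≤ s → s ≤ t → t ≤ 1 → dist (γ s) (γ t) = (t - s) * dist p q := by
    intro s t hs hst ht
    refine le_antisymm (h s t hs hst ht) ?_
    have e1 := h 0 s le_rfl hs (hst.trans ht)
    have e2 := h t 1 (hs.trans hst) ht le_rfl
    have e3 := dist_triangle4 (γ 0) (γ s) (γ t) (γ 1)
    rw [h0, h1] at e3
    rw [h0] at e1
    rw [h1] at e2
    linarith
  refine ⟨h0, h1, fun s hs t ht => ?_⟩
  rcases le_total s t with hst | hst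
  · rw [key s t hs.1 hst ht.2, abs_sub_comm, abs_of_nonneg (sub_nonneg.2 hst)]
  · rw [dist_comm, key t s ht.1 hst hs.2, abs_of_nonneg (sub_nonneg.2 hst)]

theorem IsMinimizingGeodesic.dist_eq {γ : ℝ → M} {p q : M} (h : IsMinimizingGeodesic γ p q)
    {s t : ℝ} (hs : 0 ≤ s) (hst : s ≤ t) (ht : t ≤ 1) :
    dist (γ s) (γ t) = (t - s) * dist p q := by
  rw [h.2.2 s ⟨hs, hst.trans ht⟩ t ⟨hs.trans hst, ht⟩, abs_sub_comm,
    abs_of_nonneg (sub_nonneg.2 hst)]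

theorem IsMinimizingGeodesic.trans {γ₁ γ₂ : ℝ → M} {p y q : M} {t : ℝ} (ht0 : 0 < t) (ht1 : t < 1)
    (h₁ : IsMinimizingGeodesic γ₁ p y) (h₂ : IsMinimizingGeodesic γ₂ y q)
    (hpy : dist p y = t * dist p q) (hyq : dist y q = (1 - t) * dist p q) :
    IsMinimizingGeodesic (fun s => if s ≤ t then γ₁ (s / t) else γ₂ ((s - t) / (1 - t))) p q := by
  have ht1' : 0 < 1 - t := by linarith
  have e1 : ∀ s r : ℝ, 0 ≤ s → s ≤ r → r ≤ t →
      dist (γ₁ (s / t)) (γ₁ (r / t)) = (r - s) * dist p q := by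
    intro s r hs hsr hr
    rw [h₁.dist_eq (by positivity) (by gcongr) ((div_le_one ht0).2 hr), hpy]
    field_simp
  have e2 : ∀ s r : ℝ, t ≤ s → s ≤ r → r ≤ 1 →
      dist (γ₂ ((s - t) / (1 - t))) (γ₂ ((r - t) / (1 - t))) = (r - s) * dist p q := by
    intro s r hs hsr hr
    rw [h₂.dist_eq (div_nonneg (by linarith) ht1'.le) (by gcongr)
      ((div_le_one ht1').2 (by linarith)), hyq]
    field_simp
    ring
  refine isMinimizingGeodesic_of_le ?_ ?_ fun s r hs hsr hr => ?_
  · simp [ht0.le, h₁.1]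
  · simp [not_le.2 ht1, ht1'.ne', h₂.2.1]
  · by_cases hst : s ≤ t
    · by_cases hrt : r ≤ t
      · simp only [hst, hrt, if_true]
        exact (e1 s r hs hsr hrt).le
      · simp only [hst, hrt, if_true, if_false]
        have a1 := e1 s t hs hst le_rfl
        have a2 := e2 t r le_rfl (not_le.1 hrt).le hr
        rw [div_self ht0.ne', h₁.2.1] at a1
        rw [sub_self, zero_div, h₂.1] at a2
        have := dist_triangle (γ₁ (s / t)) y (γ₂ ((r - t) / (1 - t)))
        linarith
    · have hrt : ¬ r ≤ t := fun h => hst (hsr.trans h)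
      simp only [hst, hrt, if_false]
      exact (e2 s r (not_le.1 hst).le hsr hr).le

/-- The geodesics from `p` to `y` and from `y` to `q` concatenate to a minimizing geodesic from `p`
to `q`, which is `γ` by uniqueness. The endpoint values of `t` are separate because the
concatenation divides by `t` and `1 - t`. -/
theorem IsGeodesicallyConvex.eq_of_dist {V : Set M} (hV : IsGeodesicallyConvex V) {p y q : M}
    (hp : p ∈ V) (hy : y ∈ V) (hq : q ∈ V) {γ : ℝ → M} (hγ : IsMinimizingGeodesic γ p q) {t : ℝ}
    (ht0 : 0 ≤ t) (ht1 : t ≤ 1)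
    (hpy : dist p y = t * dist p q) (hyq : dist y q = (1 - t) * dist p q) : y = γ t := by
  rcases ht0.eq_or_lt with rfl | ht0
  · rw [hγ.1]
    simpa using (dist_eq_zero.1 (by simpa using hpy)).symm
  rcases ht1.eq_or_lt with rfl | ht1
  · rw [hγ.2.1]
    exact dist_eq_zero.1 (by simpa using hyq)
  obtain ⟨γ₁, h₁, -⟩ := hV p hp y hy
  obtain ⟨γ₂, h₂, -⟩ := hV y hy q hq
  obtain ⟨γ₀, -, -, huniq⟩ := hV p hp q hq
  have hc := IsMinimizingGeodesic.trans ht0 ht1 h₁ h₂ hpy hyq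
  have := (huniq _ hc).trans (huniq _ hγ).symm ⟨ht0.le, ht1.le⟩
  simpa [ht0.ne', h₁.2.1] using this

-- A cluster point of `γ q t` as `q → x` has the distances from `p` and `x` that characterize `γ x
-- t`, provided it lies in `V`. Only local compactness is available to produce cluster points, so
-- `t` advances in small steps that keep `γ q t` in a compact neighbourhood, inside `V`, of the
-- limit geodesic.
open Filter Topology in
theorem IsGeodesicallyConvex.tendsto_geodesic [LocallyCompactSpace M] {V : Set M} (hVo : IsOpen V)
    (hV : IsGeodesicallyConvex V) {p : M} (hp : p ∈ V) (γ : M → ℝ → M)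
    (hγ : ∀ q ∈ V, IsMinimizingGeodesic (γ q) p q)
    (hγV : ∀ q ∈ V, ∀ t ∈ Set.Icc (0 : ℝ) 1, γ q t ∈ V) {x : M} (hx : x ∈ V) {t : ℝ}
    (ht : t ∈ Set.Icc (0 : ℝ) 1) :
    Tendsto (fun q => γ q t) (𝓝 x) (𝓝 (γ x t)) := by
  have hxV : ∀ᶠ q in 𝓝 x, q ∈ V := hVo.mem_nhds hx
  have hcont : ContinuousOn (γ x) (Set.Icc 0 1) := by
    have : LipschitzOnWith (Real.toNNReal (dist p x)) (γ x) (Set.Icc 0 1) := by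
      refine LipschitzOnWith.of_dist_le_mul fun s hs r hr => ?_
      rw [(hγ x hx).2.2 s hs r hr, Real.coe_toNNReal _ dist_nonneg, Real.dist_eq, mul_comm]
    exact this.continuousOn
  have hK : IsCompact (γ x '' Set.Icc 0 1) := isCompact_Icc.image_of_continuousOn hcont
  obtain ⟨K', hK', hKK', hK'V⟩ := exists_compact_between hK hVo
    (Set.image_subset_iff.2 fun s hs => hγV x hx s hs)
  obtain ⟨r, hr, hrK⟩ := hK.exists_cthickening_subset_open isOpen_interior hKK'
  have hball : ∀ s ∈ Set.Icc (0 : ℝ) 1, Metric.closedBall (γ x s) r ⊆ K' := fun s hs =>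
    ((Metric.closedBall_subset_cthickening (Set.mem_image_of_mem _ hs) r).trans hrK).trans
      interior_subset
  -- For `q` near `x` the geodesic `γ q` has speed less than `dist p x + 1`, so it moves less than
  -- `r / 2` in time `δ`; the other `r / 2` is the allowed error at the start of the step.
  obtain ⟨δ, hδ, hδr⟩ : ∃ δ > 0, δ * (dist p x + 1) < r / 2 := by
    have hd : 0 < dist p x + 1 := by positivity
    refine ⟨r / 4 / (dist p x + 1), by positivity, ?_⟩
    rw [div_mul_cancel₀ _ hd.ne']
    linarith
  have hdist : ∀ᶠ q in 𝓝 x, dist p q < dist p x + 1 :=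
    (continuous_const.dist continuous_id).continuousAt.eventually_lt continuousAt_const
      (by simp)
  have step : ∀ s ∈ Set.Icc (0 : ℝ) 1, Tendsto (fun q => γ q s) (𝓝 x) (𝓝 (γ x s)) →
      ∀ t ∈ Set.Icc s (s + δ), t ≤ 1 → Tendsto (fun q => γ q t) (𝓝 x) (𝓝 (γ x t)) := by
    intro s hs hlim t hst ht1
    have htI : t ∈ Set.Icc (0 : ℝ) 1 := ⟨hs.1.trans hst.1, ht1⟩
    refine hK'.tendsto_nhds_of_unique_mapClusterPt ?_ ?_
    · filter_upwards [hxV, hdist, hlim.eventually (Metric.ball_mem_nhds _ (half_pos hr))]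
        with q hqV hqd hqs
      apply hball s hs
      rw [Metric.mem_closedBall]
      have h1 := (hγ q hqV).dist_eq hs.1 hst.1 ht1
      have h2 := dist_triangle_left (γ q t) (γ x s) (γ q s)
      have h3 : (t - s) * dist p q ≤ δ * (dist p x + 1) := by
        have := hst.2
        gcongr
        linarith
      replace hqs : dist (γ q s) (γ x s) < r / 2 := hqs
      linarith
    · intro y hy hcl
      have hcl1 : MapClusterPt (dist p y) (𝓝 x) (fun q => dist p (γ q t)) :=
        hcl.continuousAt_comp (f := fun z => dist p z) (by fun_prop)
      have hcl2 : MapClusterPt (dist y x) (𝓝 x) (fun q => dist (γ q t) x) :=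
        hcl.continuousAt_comp (f := fun z => dist z x) (by fun_prop)
      have hl1 : Tendsto (fun q => dist p (γ q t)) (𝓝 x) (𝓝 (t * dist p x)) := by
        refine (show Tendsto (fun q => t * dist p q) (𝓝 x) (𝓝 (t * dist p x)) from
          (continuous_const.mul (continuous_const.dist continuous_id)).tendsto x).congr' ?_
        filter_upwards [hxV] with q hq
        have := (hγ q hq).dist_eq le_rfl htI.1 ht1
        rw [(hγ q hq).1] at this
        rw [this, sub_zero]
      have hl2 : Tendsto (fun q => dist (γ q t) x) (𝓝 x) (𝓝 ((1 - t) * dist p x)) := by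
        have h1 : Tendsto (fun q => dist (γ q t) q) (𝓝 x) (𝓝 ((1 - t) * dist p x)) := by
          refine (show Tendsto (fun q => (1 - t) * dist p q) (𝓝 x) (𝓝 ((1 - t) * dist p x)) from
            (continuous_const.mul (continuous_const.dist continuous_id)).tendsto x).congr' ?_
          filter_upwards [hxV] with q hq
          have := (hγ q hq).dist_eq htI.1 ht1 le_rfl
          rw [(hγ q hq).2.1] at this
          rw [this]
        have h2 : Tendsto (fun q => dist q x) (𝓝 x) (𝓝 0) := by
          simpa using (continuous_id.dist (continuous_const (y := x))).tendsto x
        refine tendsto_of_tendsto_of_dist h1 (squeeze_zero (fun _ => dist_nonneg) (fun q => ?_) h2)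
        rw [Real.dist_eq, dist_comm (γ q t) q, dist_comm (γ q t) x]
        exact abs_dist_sub_le q x (γ q t)
      have e1 : dist p y = t * dist p x := eq_of_nhds_neBot (hcl1.clusterPt.mono hl1)
      have e2 : dist y x = (1 - t) * dist p x := eq_of_nhds_neBot (hcl2.clusterPt.mono hl2)
      exact hV.eq_of_dist hp (hK'V hy) hx (hγ x hx) htI.1 ht1 e1 e2
  have ind : ∀ n : ℕ, ∀ t ∈ Set.Icc (0 : ℝ) 1, t ≤ n * δ →
      Tendsto (fun q => γ q t) (𝓝 x) (𝓝 (γ x t)) := by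
    intro n
    induction n with
    | zero =>
      intro t ht htn
      have : t = 0 := le_antisymm (by simpa using htn) ht.1
      subst this
      rw [(hγ x hx).1]
      refine tendsto_const_nhds.congr' ?_
      filter_upwards [hxV] with q hq
      rw [(hγ q hq).1]
    | succ n ih =>
      intro t ht htn
      rcases le_total t (n * δ) with h | h
      · exact ih t ht h
      · have hs : (n : ℝ) * δ ∈ Set.Icc (0 : ℝ) 1 := ⟨by positivity, h.trans ht.2⟩
        refine step _ hs (ih _ hs le_rfl) t ⟨h, ?_⟩ ht.2
        push_cast at htn
        linarith
  obtain ⟨n, hn⟩ := exists_nat_gt (1 / δ)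
  refine ind n t ht (ht.2.trans ?_)
  rw [div_lt_iff₀ hδ] at hn
  exact hn.le

-- The homotopy `(t, q) ↦ γ q t` joins the constant map at `p` to the identity. It is jointly
-- continuous because it is continuous in `q` for fixed `t` and Lipschitz in `t` with constant `dist
-- p q`, which is locally bounded.
open Filter Topology in
theorem IsGeodesicallyConvex.contractibleSpace [LocallyCompactSpace M] {V : Set M}
    (hVo : IsOpen V) (hV : IsGeodesicallyConvex V) (hne : V.Nonempty) : ContractibleSpace V := by
  obtain ⟨p, hp⟩ := hne
  have hex : ∀ q : M, ∃ γ : ℝ → M, q ∈ V → IsMinimizingGeodesic γ p q ∧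
      ∀ t ∈ Set.Icc (0 : ℝ) 1, γ t ∈ V := by
    intro q
    by_cases hq : q ∈ V
    · obtain ⟨γ, h1, h2, -⟩ := hV p hp q hq
      exact ⟨γ, fun _ => ⟨h1, h2⟩⟩
    · exact ⟨fun _ => p, fun h => absurd h hq⟩
  choose γ hγ using hex
  have hlim := fun x hx t => hV.tendsto_geodesic (x := x) (t := t) hVo hp γ (fun q hq => (hγ q hq).1) (fun q hq => (hγ q hq).2) hx
  rw [contractible_iff_id_nullhomotopic]
  refine ⟨⟨p, hp⟩, ⟨ContinuousMap.Homotopy.symm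
    { toFun := fun z => ⟨γ z.2 z.1, (hγ z.2 z.2.2).2 z.1 z.1.2⟩
      continuous_toFun := ?_
      map_zero_left := fun q => Subtype.ext (by simpa using (hγ q q.2).1.1)
      map_one_left := fun q => Subtype.ext (by simpa using (hγ q q.2).1.2.1) }⟩⟩
  refine Continuous.subtype_mk (continuous_iff_continuousAt.2 ?_) _
  rintro ⟨t, x⟩
  have h1 : Tendsto (fun z : unitInterval × V => γ z.2 t) (𝓝 (t, x)) (𝓝 (γ x t)) :=
    ((hlim x x.2 t t.2).comp (continuous_subtype_val.tendsto x)).comp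
      (continuous_snd.tendsto (t, x))
  refine tendsto_of_tendsto_of_dist h1 ?_
  have h2 : Tendsto (fun z : unitInterval × V => |(t : ℝ) - (z.1 : ℝ)| * dist p (z.2 : M))
      (𝓝 (t, x)) (𝓝 0) := by
    have : Continuous (fun z : unitInterval × V => |(t : ℝ) - (z.1 : ℝ)| * dist p (z.2 : M)) := by
      fun_prop
    simpa using this.tendsto (t, x)
  refine squeeze_zero (fun _ => dist_nonneg) (fun z => ?_) h2
  exact ((hγ z.2 z.2.2).1.2.2 t t.2 z.1 z.1.2).le

end Convex

section Calculus

set_option linter.unusedSectionVars false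

variable {E : Type*} [NormedAddCommGroup E] [NormedSpace ℝ E] [FiniteDimensional ℝ E]
  {M : Type*} [TopologicalSpace M] [ChartedSpace E M] [IsManifold 𝓘(ℝ, E) ∞ M]

/-! ### Derivatives of functions along vector fields -/

theorem contMDiffAt_mvfderiv_apply {f : M → ℝ} {V : Π x : M, TangentSpace 𝓘(ℝ, E) x} {x : M}
    {m n : WithTop ℕ∞} [IsManifold 𝓘(ℝ, E) n M]
    (hf : CMDiffAt n f x) (hV : CMDiffAt m (T% V) x) (hmn : m + 1 ≤ n) :
    CMDiffAt m (fun y => mvfderiv 𝓘(ℝ, E) f y (V y)) x := by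
  have h1 := hf.mfderiv_const hmn
  have hb : CMDiffAt m f x := hf.of_le (le_self_add.trans hmn)
  have h2 := ContMDiffAt.clm_apply_of_inCoordinates (IB₁ := 𝓘(ℝ, E)) (IB₂ := 𝓘(ℝ, ℝ))
    (F₁ := E) (F₂ := ℝ)
    (E₁ := fun x : M => TangentSpace 𝓘(ℝ, E) x) (E₂ := fun x : ℝ => TangentSpace 𝓘(ℝ, ℝ) x)
    (b₁ := id) (b₂ := f) (v := V) (ϕ := fun y => mfderiv 𝓘(ℝ, E) 𝓘(ℝ, ℝ) f y) h1 hV hb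
  exact (contMDiff_snd_tangentBundle_modelSpace ℝ 𝓘(ℝ, ℝ)).contMDiffAt.comp x h2

theorem mvfderiv_congr {f g : M → ℝ} {x : M} (h : f =ᶠ[nhds x] g) :
    mvfderiv 𝓘(ℝ, E) f x = mvfderiv 𝓘(ℝ, E) g x := by
  ext v
  simp only [mvfderiv, ContinuousLinearMap.comp_apply, h.mfderiv_eq]
  rfl

/-- The Lie bracket acts on functions as the commutator of the directional derivatives. -/
theorem mvfderiv_mlieBracket {f : M → ℝ} {V W : Π x : M, TangentSpace 𝓘(ℝ, E) x} {x : M}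
    (hf : ∀ᶠ y in nhds x, CMDiffAt ∞ f y) (hV : ∀ᶠ y in nhds x, CMDiffAt ∞ (T% V) y)
    (hW : ∀ᶠ y in nhds x, CMDiffAt ∞ (T% W) y) :
    mvfderiv 𝓘(ℝ, E) f x (mlieBracket 𝓘(ℝ, E) V W x)
      = mvfderiv 𝓘(ℝ, E) (fun y => mvfderiv 𝓘(ℝ, E) f y (W y)) x (V x)
        - mvfderiv 𝓘(ℝ, E) (fun y => mvfderiv 𝓘(ℝ, E) f y (V y)) x (W x) := by
  rcases subsingleton_or_nontrivial E with hE | hE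
  · have h0 : ∀ v : TangentSpace 𝓘(ℝ, E) x, v = 0 := fun v => @Subsingleton.elim E hE v 0
    rw [h0 (mlieBracket 𝓘(ℝ, E) V W x), h0 (V x), h0 (W x)]
    simp
  -- The formula is read off as a coefficient. Expanding the Jacobi identity for `V`, `W`, `f • Z`
  -- and removing `f` times the one for `V`, `W`, `Z` leaves the difference of the two sides times
  -- `Z x`, and `Z x = w ≠ 0`.
  obtain ⟨w, hw⟩ := exists_ne (0 : E)
  let Z : Π x : M, TangentSpace 𝓘(ℝ, E) x :=
    FiberBundle.extend E (E := fun x : M => TangentSpace 𝓘(ℝ, E) x) (x := x) (w : TangentSpace 𝓘(ℝ, E) x)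
  have hZ : ∀ᶠ y in nhds x, CMDiffAt ∞ (T% Z) y := by
    obtain ⟨s, hs, hsm⟩ := FiberBundle.exists_contMDiffOn_extend (k := ∞) 𝓘(ℝ, E) E
      (V := fun x : M => TangentSpace 𝓘(ℝ, E) x) (x₀ := x) (w : TangentSpace 𝓘(ℝ, E) x)
    obtain ⟨O, hOs, hO, hxO⟩ := mem_nhds_iff.1 hs
    filter_upwards [hO.mem_nhds hxO] with y hy
    exact hsm.contMDiffAt (Filter.mem_of_superset (hO.mem_nhds hy) hOs)
  have hZx : Z x = w := FiberBundle.extend_apply_self (F := E)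
    (E := fun x : M => TangentSpace 𝓘(ℝ, E) x) (x := x) _
  have hne : (∞ : WithTop ℕ∞) ≠ 0 := by simp
  have dm : ∀ {U : Π x : M, TangentSpace 𝓘(ℝ, E) x} {y : M}, CMDiffAt ∞ (T% U) y →
    MDiffAt (T% U) y := fun h => h.mdifferentiableAt hne
  have min2 : minSmoothness ℝ 2 ≤ (∞ : WithTop ℕ∞) := by simp; exact ENat.LEInfty.out
  have : IsManifold 𝓘(ℝ, E) (minSmoothness ℝ 2) M := IsManifold.of_le min2
  have br : ∀ {U U' : Π x : M, TangentSpace 𝓘(ℝ, E) x} {y : M}, CMDiffAt ∞ (T% U) y →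
      CMDiffAt ∞ (T% U') y → CMDiffAt ∞ (T% (mlieBracket 𝓘(ℝ, E) U U')) y := by
    intro U U' y h h'
    have : IsManifold 𝓘(ℝ, E) ((⊤ : ℕ∞) + 1 : WithTop ℕ∞) M := by
      have : ((⊤ : ℕ∞) + 1 : WithTop ℕ∞) = ∞ := rfl
      rw [this]; infer_instance
    exact ContMDiffAt.mlieBracket_vectorField (n := ⊤) (m := ⊤) h h' (by simp)
  have der : ∀ {U : Π x : M, TangentSpace 𝓘(ℝ, E) x} {y : M}, CMDiffAt ∞ f y →
      CMDiffAt ∞ (T% U) y → CMDiffAt ∞ (fun y => mvfderiv 𝓘(ℝ, E) f y (U y)) y :=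
    fun h h' => contMDiffAt_mvfderiv_apply h h' (by simp)
  have sm : ∀ {g : M → ℝ} {U : Π x : M, TangentSpace 𝓘(ℝ, E) x} {y : M}, CMDiffAt ∞ g y →
      CMDiffAt ∞ (T% U) y → CMDiffAt ∞ (T% (g • U)) y := fun h h' => h.smul_section h'
  have e1 : ∀ {U : Π x : M, TangentSpace 𝓘(ℝ, E) x}, (∀ᶠ y in nhds x, CMDiffAt ∞ (T% U) y) →
      mlieBracket 𝓘(ℝ, E) U (f • Z) =ᶠ[nhds x]
      (fun y => mvfderiv 𝓘(ℝ, E) f y (U y)) • Z + f • mlieBracket 𝓘(ℝ, E) U Z := by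
    intro U hU
    filter_upwards [hf, hU, hZ] with y hfy hUy hZy
    exact mlieBracket_smul_right (hfy.mdifferentiableAt hne) (dm hZy)
  have hfx := hf.self_of_nhds
  have hVx := hV.self_of_nhds
  have hWx := hW.self_of_nhds
  have hZx' := hZ.self_of_nhds
  have e2 : ∀ {U U' : Π x : M, TangentSpace 𝓘(ℝ, E) x}, (∀ᶠ y in nhds x, CMDiffAt ∞ (T% U) y) →
      CMDiffAt ∞ (T% U') x →
      mlieBracket 𝓘(ℝ, E) U' (mlieBracket 𝓘(ℝ, E) U (f • Z)) x =
      mvfderiv 𝓘(ℝ, E) (fun y => mvfderiv 𝓘(ℝ, E) f y (U y)) x (U' x) • Z x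
        + mvfderiv 𝓘(ℝ, E) f x (U x) • mlieBracket 𝓘(ℝ, E) U' Z x
        + (mvfderiv 𝓘(ℝ, E) f x (U' x) • mlieBracket 𝓘(ℝ, E) U Z x
        + f x • mlieBracket 𝓘(ℝ, E) U' (mlieBracket 𝓘(ℝ, E) U Z) x) := by
    intro U U' hU hU'
    have hUx := hU.self_of_nhds
    rw [Filter.EventuallyEq.mlieBracket_vectorField_eq (Filter.EventuallyEq.refl _ U') (e1 hU),
      mlieBracket_add_right (dm (sm (der hfx hUx) hZx')) (dm (sm hfx (br hUx hZx'))),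
      mlieBracket_smul_right ((der hfx hUx).mdifferentiableAt hne) (dm hZx'),
      mlieBracket_smul_right (hfx.mdifferentiableAt hne) (dm (br hUx hZx'))]
  have : IsManifold 𝓘(ℝ, E) (minSmoothness ℝ 3) M := by
    have : minSmoothness ℝ 3 ≤ (∞ : WithTop ℕ∞) := by simp; exact ENat.LEInfty.out
    exact IsManifold.of_le this
  have J1 := leibniz_identity_mlieBracket_apply (I := 𝓘(ℝ, E)) (U := V) (V := W) (W := f • Z) (x := x)
    (hVx.of_le min2) (hWx.of_le min2) ((sm hfx hZx').of_le min2)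
  have J2 := leibniz_identity_mlieBracket_apply (I := 𝓘(ℝ, E)) (U := V) (V := W) (W := Z) (x := x)
    (hVx.of_le min2) (hWx.of_le min2) (hZx'.of_le min2)
  rw [e2 hW hVx, e2 hV hWx, mlieBracket_smul_right (hfx.mdifferentiableAt hne) (dm hZx'), J2] at J1
  have J3 : (mvfderiv 𝓘(ℝ, E) f x (mlieBracket 𝓘(ℝ, E) V W x)
      - (mvfderiv 𝓘(ℝ, E) (fun y => mvfderiv 𝓘(ℝ, E) f y (W y)) x (V x)
        - mvfderiv 𝓘(ℝ, E) (fun y => mvfderiv 𝓘(ℝ, E) f y (V y)) x (W x))) • Z x = 0 := by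
    have := sub_eq_zero.2 J1
    rw [← neg_eq_zero, ← this]
    module
  rw [hZx] at J3
  rcases smul_eq_zero.1 J3 with h | h
  · linarith
  · exact absurd h hw

end Calculus

section Primitive

set_option linter.unusedSectionVars false

variable {E : Type*} [NormedAddCommGroup E] [NormedSpace ℝ E] [FiniteDimensional ℝ E]
  {M : Type*} [TopologicalSpace M] [ChartedSpace E M] [IsManifold 𝓘(ℝ, E) ∞ M]

/-! ### Primitives of closed one-forms -/

/-- In a chart this is the mean value theorem on a ball, which is convex. -/
theorem eventually_eq_of_mvfderiv_eq_zero {g : M → ℝ} {x : M}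
    (hg : ∀ᶠ y in nhds x, MDiffAt g y ∧ mvfderiv 𝓘(ℝ, E) g y = 0) :
    ∀ᶠ y in nhds x, g y = g x := by
  set e := extChartAt 𝓘(ℝ, E) x with he
  have hx : x ∈ e.source := mem_extChartAt_source x
  have hsymm : ContinuousAt e.symm (e x) := continuousAt_extChartAt_symm x
  have h1 : ∀ᶠ z in nhds (e x), MDiffAt g (e.symm z) ∧ mvfderiv 𝓘(ℝ, E) g (e.symm z) = 0 := by
    have : Filter.Tendsto e.symm (nhds (e x)) (nhds x) := by
      have h := hsymm.tendsto
      rwa [e.left_inv hx] at h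
    exact this.eventually hg
  have h2 : ∀ᶠ z in nhds (e x), z ∈ e.target := extChartAt_target_mem_nhds x
  obtain ⟨ε, hε, hball⟩ := Metric.eventually_nhds_iff_ball.1 (h1.and h2)
  have hder : ∀ z ∈ Metric.ball (e x) ε, HasFDerivAt (g ∘ e.symm) (0 : E →L[ℝ] ℝ) z := by
    intro z hz
    obtain ⟨⟨hgd, hg0⟩, hzt⟩ := hball z hz
    have hs : MDifferentiableAt 𝓘(ℝ, E) 𝓘(ℝ, E) e.symm z :=
      ((contMDiffOn_extChartAt_symm (n := ∞) x).contMDiffAt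
        ((isOpen_extChartAt_target x).mem_nhds hzt)).mdifferentiableAt (by simp)
    have hc : MDifferentiableAt 𝓘(ℝ, E) 𝓘(ℝ, ℝ) (g ∘ e.symm) z := hgd.comp z hs
    have h0 : mfderiv 𝓘(ℝ, E) 𝓘(ℝ, ℝ) (g ∘ e.symm) z = 0 := by
      ext v
      have := mvfderiv_comp_apply z hgd hs v
      rw [hg0] at this
      exact this
    have hd : DifferentiableAt ℝ (g ∘ e.symm) z := mdifferentiableAt_iff_differentiableAt.1 hc
    rw [mfderiv_eq_fderiv] at h0
    have := hd.hasFDerivAt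
    rw [h0] at this
    exact this
  have hconst : ∀ z ∈ Metric.ball (e x) ε, (g ∘ e.symm) z = (g ∘ e.symm) (e x) := fun z hz =>
    (convex_ball (e x) ε).is_const_of_fderivWithin_eq_zero (𝕜 := ℝ)
      (fun w hw => (hder w hw).differentiableAt.differentiableWithinAt)
      (fun w hw => by
        rw [fderivWithin_of_isOpen Metric.isOpen_ball hw]
        exact (hder w hw).fderiv) hz (Metric.mem_ball_self hε)
  have hcont : ContinuousAt e x := continuousAt_extChartAt x
  filter_upwards [hcont (Metric.ball_mem_nhds _ hε), extChartAt_source_mem_nhds (I := 𝓘(ℝ, E)) x]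
    with y hy hys
  have := hconst (e y) hy
  simpa [e.left_inv hys, e.left_inv hx] using this

/-- The condition `dα = 0` for a one-form `α`. -/
def IsClosedForm (α : Π x : M, TangentSpace 𝓘(ℝ, E) x →L[ℝ] ℝ) : Prop :=
  ∀ (x : M) (X Y : Π x : M, TangentSpace 𝓘(ℝ, E) x),
    MDiffAt (T% X) x → MDiffAt (T% Y) x →
      mvfderiv 𝓘(ℝ, E) (fun y => α y (Y y)) x (X x)
        - mvfderiv 𝓘(ℝ, E) (fun y => α y (X y)) x (Y x)
        - α x (mlieBracket 𝓘(ℝ, E) X Y x) = 0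

/-- Smoothness of a one-form. -/
def IsSmoothForm (α : Π x : M, TangentSpace 𝓘(ℝ, E) x →L[ℝ] ℝ) : Prop :=
  ContMDiff 𝓘(ℝ, E) (𝓘(ℝ, E).prod 𝓘(ℝ, E →L[ℝ] ℝ)) ∞
    (fun x => TotalSpace.mk' (E →L[ℝ] ℝ)
      (E := fun x : M => TangentSpace 𝓘(ℝ, E) x →L[ℝ] ℝ) x (α x))

theorem IsSmoothForm.contMDiffAt_apply {α : Π x : M, TangentSpace 𝓘(ℝ, E) x →L[ℝ] ℝ}
    (hα : IsSmoothForm α) {X : Π x : M, TangentSpace 𝓘(ℝ, E) x} {x : M} {n : WithTop ℕ∞}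
    (hn : n ≤ ∞) (hX : CMDiffAt n (T% X) x) : CMDiffAt n (fun y => α y (X y)) x := by
  have h := ContMDiffAt.clm_bundle_apply (F₁ := E) (F₂ := ℝ)
    (E₁ := fun x : M => TangentSpace 𝓘(ℝ, E) x) (E₂ := Bundle.Trivial M ℝ) (b := id)
    (ϕ := α) (v := X) ((hα x).of_le hn) hX
  rw [contMDiffAt_totalSpace] at h
  exact h.2

/-- The Poincaré lemma on a ball in a chart. Evaluated on coordinate fields, whose brackets vanish,
closedness says that the derivative of the coordinate expression `η` of `α` is symmetric. -/
theorem exists_local_primitive {α : Π x : M, TangentSpace 𝓘(ℝ, E) x →L[ℝ] ℝ}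
    (hs : IsSmoothForm α) (hc : IsClosedForm α) (x₀ : M) :
    ∃ (O : Set M) (ψ : M → ℝ), IsOpen O ∧ x₀ ∈ O ∧ CMDiff[O] ∞ ψ ∧
      ∀ y ∈ O, mvfderiv 𝓘(ℝ, E) ψ y = α y := by
  set e := extChartAt 𝓘(ℝ, E) x₀ with he
  have hx : x₀ ∈ e.source := mem_extChartAt_source x₀
  have hso : IsOpen e.source := isOpen_extChartAt_source x₀
  have hto : IsOpen e.target := isOpen_extChartAt_target x₀
  have hinv : ∀ y ∈ e.source, (mfderiv 𝓘(ℝ, E) 𝓘(ℝ, E) e y).IsInvertible := fun y hy =>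
    isInvertible_mfderiv_extChartAt hy
  have hecont : ∀ y ∈ e.source, CMDiffAt ∞ e y := fun y hy => contMDiffAt_extChartAt' (by
    simpa [he] using hy)
  have hsymm : ∀ z ∈ e.target, ContMDiffAt 𝓘(ℝ, E) 𝓘(ℝ, E) ∞ e.symm z := fun z hz =>
    (contMDiffOn_extChartAt_symm (n := ∞) x₀).contMDiffAt (hto.mem_nhds hz)
  let C : E → Π z : E, TangentSpace 𝓘(ℝ, E) z := fun w _ => w
  have hC : ∀ (w z : E), CMDiffAt ∞ (T% (C w)) z := fun w z => by
    rw [contMDiffAt_vectorSpace_iff_contDiffAt]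
    exact contDiffAt_const
  let W : E → Π y : M, TangentSpace 𝓘(ℝ, E) y := fun w => mpullback 𝓘(ℝ, E) 𝓘(ℝ, E) e (C w)
  have hW : ∀ w, ∀ y ∈ e.source, CMDiffAt ∞ (T% (W w)) y := fun w y hy =>
    ContMDiffAt.mpullback_vectorField_preimage (hC w (e y)) (hecont y hy) (hinv y hy) (by simp)
  let η : E → E →L[ℝ] ℝ := fun z =>
    (α (e.symm z)).comp (mfderiv 𝓘(ℝ, E) 𝓘(ℝ, E) e (e.symm z)).inverse
  have hηW : ∀ z w, η z w = α (e.symm z) (W w (e.symm z)) := fun z w => rfl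
  have hηs : ContDiffOn ℝ ∞ η e.target := by
    rw [contDiffOn_clm_apply]
    intro w z hz
    have h1 : CMDiffAt ∞ (fun y => α y (W w y)) (e.symm z) :=
      hs.contMDiffAt_apply le_rfl (hW w _ (e.map_target hz))
    exact ((h1.comp z (hsymm z hz)).contDiffAt).contDiffWithinAt
  have hηd : ∀ z ∈ e.target, DifferentiableAt ℝ η z := fun z hz =>
    ((hηs.contDiffAt (hto.mem_nhds hz)).differentiableAt (by simp))
  have hder : ∀ z ∈ e.target, ∀ u w, mvfderiv 𝓘(ℝ, E) (fun y => α y (W w y)) (e.symm z)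
      (W u (e.symm z)) = fderiv ℝ η z u w := by
    intro z hz u w
    have hy := e.map_target hz
    have hez : e (e.symm z) = z := e.right_inv hz
    have h1 : (fun y => α y (W w y)) =ᶠ[nhds (e.symm z)] (fun z => η z w) ∘ e := by
      filter_upwards [hso.mem_nhds hy] with y hy'
      exact congrArg (fun q => α q (W w q)) (e.left_inv hy').symm
    have hd : DifferentiableAt ℝ (fun z => η z w) (e (e.symm z)) := by
      rw [hez]
      exact (hηd z hz).clm_apply (differentiableAt_const w)
    rw [mvfderiv_congr h1, mvfderiv_comp_apply _ hd.mdifferentiableAt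
      ((hecont _ hy).mdifferentiableAt (by simp))]
    have h2 : mfderiv 𝓘(ℝ, E) 𝓘(ℝ, E) e (e.symm z) (W u (e.symm z)) = u :=
      (hinv _ hy).self_apply_inverse _
    rw [h2]
    have h3 : mvfderiv 𝓘(ℝ, E) (fun z => η z w) (e (e.symm z)) u
        = fderiv ℝ (fun z => η z w) (e (e.symm z)) u := by
      simp only [mvfderiv, mfderiv_eq_fderiv]
      rfl
    rw [h3, hez, fderiv_clm_apply (hηd z hz) (differentiableAt_const w)]
    simp
  have hsym : ∀ z ∈ e.target, ∀ u w, fderiv ℝ η z u w = fderiv ℝ η z w u := by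
    intro z hz u w
    have hy := e.map_target hz
    have hcl := hc (e.symm z) (W u) (W w) ((hW u _ hy).mdifferentiableAt (by simp))
      ((hW w _ hy).mdifferentiableAt (by simp))
    have min2 : minSmoothness ℝ 2 ≤ (∞ : WithTop ℕ∞) := by simp; exact ENat.LEInfty.out
    have : IsManifold 𝓘(ℝ, E) (minSmoothness ℝ 2) M := IsManifold.of_le min2
    -- Pullback by the chart respects brackets, and constant fields on `E` commute.
    have hbr : mlieBracket 𝓘(ℝ, E) (W u) (W w) (e.symm z) = 0 := by
      rw [← mpullback_mlieBracket ((hC u _).mdifferentiableAt (by simp))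
        ((hC w _).mdifferentiableAt (by simp)) (hecont _ hy) min2]
      have h0 : mlieBracket 𝓘(ℝ, E) (C u) (C w) = 0 := by
        rw [← mlieBracketWithin_univ, mlieBracketWithin_eq_lieBracketWithin, lieBracketWithin_univ]
        ext z
        simp only [lieBracket, fderiv_fun_const, Pi.zero_apply, zero_apply,
          sub_self]
        rfl
      rw [h0]
      simp
    rw [hbr, hder z hz, hder z hz] at hcl
    simpa [sub_eq_zero] using hcl
  obtain ⟨ε, hε, hball⟩ := Metric.isOpen_iff.1 hto (e x₀) (e.map_source hx)
  obtain ⟨f, hf⟩ := (convex_ball (e x₀) ε).exists_forall_hasFDerivAt_of_fderiv_symmetric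
    Metric.isOpen_ball (fun z hz => (hηd z (hball hz)).differentiableWithinAt)
    (fun z hz u w => hsym z (hball hz) u w)
  have hfs : ContDiffOn ℝ ∞ f (Metric.ball (e x₀) ε) := by
    rw [contDiffOn_infty_iff_fderiv_of_isOpen Metric.isOpen_ball]
    exact ⟨fun z hz => (hf z hz).differentiableAt.differentiableWithinAt,
      (hηs.mono hball).congr fun z hz => (hf z hz).fderiv⟩
  have hOo : IsOpen (e.source ∩ e ⁻¹' Metric.ball (e x₀) ε) :=
    (continuousOn_extChartAt x₀).isOpen_inter_preimage hso Metric.isOpen_ball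
  refine ⟨_, f ∘ e, hOo, ⟨hx, Metric.mem_ball_self hε⟩, ?_, ?_⟩
  · intro y hy
    exact (((hfs.contDiffAt (Metric.isOpen_ball.mem_nhds hy.2)).contMDiffAt).comp y
      (hecont y hy.1)).contMDiffWithinAt
  · intro y hy
    ext v
    have hfd := (hf (e y) hy.2).differentiableAt
    rw [mvfderiv_comp_apply _ hfd.mdifferentiableAt ((hecont _ hy.1).mdifferentiableAt (by simp))]
    have h3 : mvfderiv 𝓘(ℝ, E) f (e y) (mfderiv 𝓘(ℝ, E) 𝓘(ℝ, E) e y v)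
        = fderiv ℝ f (e y) (mfderiv 𝓘(ℝ, E) 𝓘(ℝ, E) e y v) := by
      simp only [mvfderiv, mfderiv_eq_fderiv]
      rfl
    rw [h3, (hf (e y) hy.2).fderiv]
    change α (e.symm (e y)) ((mfderiv 𝓘(ℝ, E) 𝓘(ℝ, E) e (e.symm (e y))).inverse _) = _
    rw [e.left_inv hy.1, (hinv y hy.1).inverse_apply_self]

theorem exists_primitive {α : Π x : M, TangentSpace 𝓘(ℝ, E) x →L[ℝ] ℝ}
    (hs : IsSmoothForm α) (hc : IsClosedForm α) {V : Set M} (hV : IsOpen V)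
    [SimplyConnectedSpace V] :
    ∃ φ : M → ℝ, CMDiff[V] ∞ φ ∧ ∀ y ∈ V, mvfderiv 𝓘(ℝ, E) φ y = α y := by
  choose O ψ hO hmem hψs hψd using exists_local_primitive hs hc
  have hLP : LocallyPathConnectedSpace M := ChartedSpace.locallyPathConnectedSpace E M
  have hLV : LocallyPathConnectedSpace V := hV.locallyPathConnectedSpace
  have hψm : ∀ i, ∀ y ∈ O i, MDiffAt (ψ i) y := fun i y hy =>
    ((hψs i).contMDiffAt ((hO i).mem_nhds hy)).mdifferentiableAt (by simp)
  obtain ⟨φ, hφ⟩ := exists_primitive_of_locally (X := V)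
    (fun i => Subtype.val ⁻¹' O i) (fun i => (hO i).preimage continuous_subtype_val)
    (fun i => hmem i) (fun i y => ψ i y) (by
      intro i j x hx
      have := eventually_eq_of_mvfderiv_eq_zero (E := E) (g := fun y => ψ i y - ψ j y) (x := (x : M)) (by
        filter_upwards [(hO i).mem_nhds hx.1, (hO j).mem_nhds hx.2] with y hi hj
        refine ⟨(hψm i y hi).sub (hψm j y hj), ?_⟩
        rw [mvfderiv_fun_sub (hψm i y hi) (hψm j y hj), hψd i y hi, hψd j y hj, sub_self])
      exact continuous_subtype_val.continuousAt.eventually this)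
  classical
  -- The value outside `V` is arbitrary; as `V` is open, germs at its points do not see it.
  let Φ : M → ℝ := fun y => if h : y ∈ V then φ ⟨y, h⟩ else 0
  have hΦ : ∀ x ∈ V, Φ =ᶠ[nhds x] fun y => ψ x y + (Φ x - ψ x x) := by
    intro x hx
    have h1 := hφ ⟨x, hx⟩ ⟨x, hx⟩ (hmem x)
    have h2 : Filter.map Subtype.val (nhds (⟨x, hx⟩ : V)) = nhds x :=
      hV.isOpenEmbedding_subtypeVal.map_nhds_eq ⟨x, hx⟩
    have h3 : ∀ᶠ y in nhds x, Φ y - ψ x y = Φ x - ψ x x := by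
      rw [← h2, Filter.eventually_map]
      filter_upwards [h1] with y hy
      simpa [Φ, hx] using hy
    filter_upwards [h3] with y hy
    linarith
  refine ⟨Φ, fun x hx => ?_, fun x hx => ?_⟩
  · have h1 : CMDiffAt ∞ (fun y => ψ x y + (Φ x - ψ x x)) x :=
      ((hψs x).contMDiffAt ((hO x).mem_nhds (hmem x))).add contMDiffAt_const
    exact (h1.congr_of_eventuallyEq (hΦ x hx)).contMDiffWithinAt
  · rw [mvfderiv_congr (hΦ x hx), mvfderiv_fun_add (hψm x x (hmem x)) mdifferentiableAt_const,
      mvfderiv_const, add_zero, hψd x x (hmem x)]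

end Primitive

/-! ### Smoothness of the isomorphism between covectors and vectors -/

section Sharp

set_option linter.unusedSectionVars false

variable {E : Type*} [NormedAddCommGroup E] [NormedSpace ℝ E] [FiniteDimensional ℝ E]
  {M : Type*} [TopologicalSpace M] [ChartedSpace E M] [IsManifold 𝓘(ℝ, E) ∞ M]
  [RiemannianBundle (fun x : M => TangentSpace 𝓘(ℝ, E) x)]
  [IsContMDiffRiemannianBundle 𝓘(ℝ, E) ∞ E (fun x : M => TangentSpace 𝓘(ℝ, E) x)]

/-- `sharp` is the fibrewise inverse of the metric viewed as a map to the dual. In trivializations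
the metric is a smooth family of invertible operators, and inversion is smooth on these. -/
theorem contMDiffAt_sharp {α : Π x : M, TangentSpace 𝓘(ℝ, E) x →L[ℝ] ℝ}
    (hα : IsSmoothForm α) (x₀ : M) :
    CMDiffAt ∞ (T% (fun x => sharp (α x))) x₀ := by
  obtain ⟨g, hg, hgi⟩ := IsContMDiffRiemannianBundle.exists_contMDiff (IB := 𝓘(ℝ, E)) (n := ∞)
    (F := E) (E := fun x : M => TangentSpace 𝓘(ℝ, E) x)
  have hsharp : ∀ (x : M) (θ : TangentSpace 𝓘(ℝ, E) x →L[ℝ] ℝ), g x (sharp θ) = θ := fun x θ => by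
    ext v
    rw [← hgi, inner_sharp]
  have hsharp' : ∀ (x : M) (v : TangentSpace 𝓘(ℝ, E) x), sharp (g x v) = v := fun x v =>
    ext_inner_right ℝ fun w => by rw [inner_sharp, hgi]
  have hinv : ∀ x : M, (g x).IsInvertible := fun x => by
    have : FiniteDimensional ℝ (TangentSpace 𝓘(ℝ, E) x) := inferInstanceAs (FiniteDimensional ℝ E)
    let S : (TangentSpace 𝓘(ℝ, E) x →L[ℝ] ℝ) →ₗ[ℝ] TangentSpace 𝓘(ℝ, E) x :=
      { toFun := sharp
        map_add' := fun a b => ext_inner_right ℝ fun w => by simp [inner_sharp, inner_add_left]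
        map_smul' := fun c a => ext_inner_right ℝ fun w => by simp [inner_sharp, inner_smul_left] }
    refine ContinuousLinearMap.IsInvertible.of_inverse (g := LinearMap.toContinuousLinearMap S) ?_ ?_
    · ext θ : 1
      exact hsharp x θ
    · ext v
      exact hsharp' x v
  have heq : ∀ x : M, (g x).inverse (α x) = sharp (α x) := fun x => by
    conv_lhs => rw [← hsharp x (α x)]
    exact (hinv x).inverse_apply_self _
  let ϕ : Π x : M, (TangentSpace 𝓘(ℝ, E) x →L[ℝ] ℝ) →L[ℝ] TangentSpace 𝓘(ℝ, E) x :=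
    fun x => (g x).inverse
  suffices hϕ : CMDiffAt ∞ (fun x : M => ContinuousLinearMap.inCoordinates
      (E →L[ℝ] ℝ) (fun x : M => TangentSpace 𝓘(ℝ, E) x →L[ℝ] Bundle.Trivial M ℝ x)
      E (fun x : M => TangentSpace 𝓘(ℝ, E) x) x₀ x x₀ x (ϕ x)) x₀ by
    have h := ContMDiffAt.clm_apply_of_inCoordinates (IB₁ := 𝓘(ℝ, E)) (IB₂ := 𝓘(ℝ, E))
      (F₁ := E →L[ℝ] ℝ) (F₂ := E)
      (E₁ := fun x : M => TangentSpace 𝓘(ℝ, E) x →L[ℝ] Bundle.Trivial M ℝ x)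
      (E₂ := fun x : M => TangentSpace 𝓘(ℝ, E) x) (b₁ := id) (b₂ := id) (v := α) (ϕ := ϕ)
      hϕ (hα x₀) contMDiffAt_id
    refine h.congr_of_eventuallyEq (Filter.Eventually.of_forall fun x => ?_)
    simp only [ϕ, id, heq]
  have h1 : CMDiffAt ∞ (fun x : M => ContinuousLinearMap.inCoordinates
      E (fun x : M => TangentSpace 𝓘(ℝ, E) x)
      (E →L[ℝ] ℝ) (fun x : M => TangentSpace 𝓘(ℝ, E) x →L[ℝ] Bundle.Trivial M ℝ x)
      x₀ x x₀ x (g x)) x₀ := ((contMDiffAt_hom_bundle _).1 (hg x₀)).2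
  have h2 : CMDiffAt ∞ (ContinuousLinearMap.inverse ∘ (fun x : M =>
      ContinuousLinearMap.inCoordinates
      E (fun x : M => TangentSpace 𝓘(ℝ, E) x)
      (E →L[ℝ] ℝ) (fun x : M => TangentSpace 𝓘(ℝ, E) x →L[ℝ] Bundle.Trivial M ℝ x)
      x₀ x x₀ x (g x))) x₀ := by
    refine ContMDiffAt.comp x₀ ?_ h1
    apply ContDiffAt.contMDiffAt
    apply ContinuousLinearMap.IsInvertible.contDiffAt_map_inverse
    rw [ContinuousLinearMap.inCoordinates_eq (FiberBundle.mem_baseSet_trivializationAt' x₀)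
      (FiberBundle.mem_baseSet_trivializationAt' x₀)]
    exact ContinuousLinearMap.isInvertible_equiv.comp
      ((hinv x₀).comp ContinuousLinearMap.isInvertible_equiv)
  refine h2.congr_of_eventuallyEq ?_
  have A : (trivializationAt E (fun x : M => TangentSpace 𝓘(ℝ, E) x) x₀).baseSet ∈ nhds x₀ :=
    (trivializationAt _ _ _).open_baseSet.mem_nhds (FiberBundle.mem_baseSet_trivializationAt' _)
  have B : (trivializationAt (E →L[ℝ] ℝ)
      (fun x : M => TangentSpace 𝓘(ℝ, E) x →L[ℝ] Bundle.Trivial M ℝ x) x₀).baseSet ∈ nhds x₀ :=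
    (trivializationAt _ _ _).open_baseSet.mem_nhds (FiberBundle.mem_baseSet_trivializationAt' _)
  filter_upwards [A, B] with x hx h'x
  simp only [Function.comp_apply]
  rw [ContinuousLinearMap.inCoordinates_eq hx h'x, ContinuousLinearMap.inCoordinates_eq h'x hx]
  simp only [ContinuousLinearMap.inverse_equiv_comp, ContinuousLinearMap.inverse_comp_equiv,
    ContinuousLinearEquiv.symm_symm, ϕ]
  rfl

end Sharp

section LeviCivita

set_option linter.unusedSectionVars false

variable {E : Type*} [NormedAddCommGroup E] [NormedSpace ℝ E] [FiniteDimensional ℝ E]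
  {M : Type*} [TopologicalSpace M] [ChartedSpace E M] [IsManifold 𝓘(ℝ, E) ∞ M]
  [RiemannianBundle (fun x : M => TangentSpace 𝓘(ℝ, E) x)]
  [IsContMDiffRiemannianBundle 𝓘(ℝ, E) ∞ E (fun x : M => TangentSpace 𝓘(ℝ, E) x)]

/-! ### The Levi-Civita connection and Lie derivatives -/

theorem leviCivita_sub_swap {X Y : Π x : M, TangentSpace 𝓘(ℝ, E) x} {x : M}
    (hX : MDiffAt (T% X) x) (hY : MDiffAt (T% Y) x) :
    leviCivita Y x (X x) - leviCivita X x (Y x) = mlieBracket 𝓘(ℝ, E) X Y x :=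
  (CovariantDerivative.torsion_eq_zero_iff _).1 leviCivita_torsion hX hY

theorem leviCivita_smul {f : M → ℝ} {Y : Π x : M, TangentSpace 𝓘(ℝ, E) x} {x : M}
    (hf : MDiffAt f x) (hY : MDiffAt (T% Y) x) (u : TangentSpace 𝓘(ℝ, E) x) :
    leviCivita (fun y => f y • Y y) x u
      = f x • leviCivita Y x u + mvfderiv 𝓘(ℝ, E) f x u • Y x := by
  have h := (leviCivita (E := E) (M := M)).isCovariantDerivativeOnUniv.leibniz hY hf (Set.mem_univ x)
  have h2 := congrArg (fun L : TangentSpace 𝓘(ℝ, E) x →L[ℝ] TangentSpace 𝓘(ℝ, E) x => L u) h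
  exact h2

/-- `X` is smooth in a neighbourhood of `x`. -/
def IsSmoothNear (X : Π x : M, TangentSpace 𝓘(ℝ, E) x) (x : M) : Prop :=
  ∀ᶠ y in nhds x, CMDiffAt ∞ (T% X) y

theorem IsSmoothNear.mdiffAt {X : Π x : M, TangentSpace 𝓘(ℝ, E) x} {x : M}
    (h : IsSmoothNear X x) : MDiffAt (T% X) x :=
  h.self_of_nhds.mdifferentiableAt (by simp)

theorem IsSmoothNear.eventually_mdiffAt {X : Π x : M, TangentSpace 𝓘(ℝ, E) x} {x : M}
    (h : IsSmoothNear X x) : ∀ᶠ y in nhds x, MDiffAt (T% X) y :=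
  h.mono fun _ hy => hy.mdifferentiableAt (by simp)

theorem exists_isSmoothNear (x : M) (v : TangentSpace 𝓘(ℝ, E) x) :
    ∃ Z : Π x : M, TangentSpace 𝓘(ℝ, E) x, IsSmoothNear Z x ∧ Z x = v := by
  refine ⟨FiberBundle.extend E (E := fun x : M => TangentSpace 𝓘(ℝ, E) x) v, ?_,
    FiberBundle.extend_apply_self (F := E) (E := fun x : M => TangentSpace 𝓘(ℝ, E) x) v⟩
  obtain ⟨s, hs, hsm⟩ := FiberBundle.exists_contMDiffOn_extend (k := ∞) 𝓘(ℝ, E) E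
    (V := fun x : M => TangentSpace 𝓘(ℝ, E) x) (x₀ := x) v
  obtain ⟨O, hOs, hO, hxO⟩ := mem_nhds_iff.1 hs
  filter_upwards [hO.mem_nhds hxO] with y hy
  exact hsm.contMDiffAt (Filter.mem_of_superset (hO.mem_nhds hy) hOs)

theorem contMDiffAt_inner {X Y : Π x : M, TangentSpace 𝓘(ℝ, E) x} {x : M}
    (hX : CMDiffAt ∞ (T% X) x) (hY : CMDiffAt ∞ (T% Y) x) :
    CMDiffAt ∞ (fun y => (inner ℝ (X y) (Y y) : ℝ)) x :=
  ContMDiffAt.inner_bundle (E := fun x : M => TangentSpace 𝓘(ℝ, E) x) hX hY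

theorem contMDiffAt_mlieBracket {X Y : Π x : M, TangentSpace 𝓘(ℝ, E) x} {x : M}
    (hX : CMDiffAt ∞ (T% X) x) (hY : CMDiffAt ∞ (T% Y) x) :
    CMDiffAt ∞ (T% (mlieBracket 𝓘(ℝ, E) X Y)) x := by
  have : IsManifold 𝓘(ℝ, E) ((⊤ : ℕ∞) + 1 : WithTop ℕ∞) M := by
    have : ((⊤ : ℕ∞) + 1 : WithTop ℕ∞) = ∞ := rfl
    rw [this]; infer_instance
  have min2 : minSmoothness ℝ 2 ≤ (∞ : WithTop ℕ∞) := by simp; exact ENat.LEInfty.out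
  have : IsManifold 𝓘(ℝ, E) (minSmoothness ℝ 2) M := IsManifold.of_le min2
  exact ContMDiffAt.mlieBracket_vectorField (n := ⊤) (m := ⊤) hX hY (by simp)

/-- The form of the Killing equation used below: `∇X` is skew at each point. -/
theorem lieDerivMetric_eq {X Y Z : Π x : M, TangentSpace 𝓘(ℝ, E) x} {x : M}
    (hX : MDiffAt (T% X) x) (hY : MDiffAt (T% Y) x) (hZ : MDiffAt (T% Z) x) :
    lieDerivMetric X Y Z x = inner ℝ (leviCivita X x (Y x)) (Z x)
      + inner ℝ (Y x) (leviCivita X x (Z x)) := by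
  rw [lieDerivMetric, leviCivita_metric hX hY hZ, ← leviCivita_sub_swap hX hY,
    ← leviCivita_sub_swap hX hZ, inner_sub_left, inner_sub_right]
  ring

variable {J : Π x : M, TangentSpace 𝓘(ℝ, E) x →L[ℝ] TangentSpace 𝓘(ℝ, E) x}

theorem IsKahler.contMDiffAt (hJ : IsKahler J) {X : Π x : M, TangentSpace 𝓘(ℝ, E) x} {x : M}
    (hX : CMDiffAt ∞ (T% X) x) : CMDiffAt ∞ (T% (fun y => J y (X y))) x :=
  ContMDiffAt.clm_bundle_apply (F₁ := E) (F₂ := E)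
    (E₁ := fun x : M => TangentSpace 𝓘(ℝ, E) x) (E₂ := fun x : M => TangentSpace 𝓘(ℝ, E) x)
    (b := id) (ϕ := J) (v := X) (hJ.smooth x) hX

theorem IsKahler.mdiffAt (hJ : IsKahler J) {X : Π x : M, TangentSpace 𝓘(ℝ, E) x} {x : M}
    (hX : MDiffAt (T% X) x) : MDiffAt (T% (fun y => J y (X y))) x :=
  MDifferentiableAt.clm_bundle_apply (F₁ := E) (F₂ := E)
    (E₁ := fun x : M => TangentSpace 𝓘(ℝ, E) x) (E₂ := fun x : M => TangentSpace 𝓘(ℝ, E) x)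
    (b := id) (ϕ := J) (v := X) ((hJ.smooth x).mdifferentiableAt (by simp)) hX

theorem IsKahler.isSmoothNear (hJ : IsKahler J) {X : Π x : M, TangentSpace 𝓘(ℝ, E) x} {x : M}
    (hX : IsSmoothNear X x) : IsSmoothNear (fun y => J y (X y)) x :=
  hX.mono fun _ h => hJ.contMDiffAt h

/-- With `J` parallel the term `∇_X Y` cancels, so holomorphy becomes commutation of `∇X` with `J`.
-/
theorem lieDerivJ_eq (hJ : IsKahler J) {X Y : Π x : M, TangentSpace 𝓘(ℝ, E) x} {x : M}
    (hX : MDiffAt (T% X) x) (hY : MDiffAt (T% Y) x) :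
    lieDerivJ J X Y x = J x (leviCivita X x (Y x)) - leviCivita X x (J x (Y x)) := by
  rw [lieDerivJ, ← leviCivita_sub_swap hX hY, ← leviCivita_sub_swap hX (hJ.mdiffAt hY),
    hJ.parallel Y x hY, map_sub]
  abel

theorem IsKahler.inner_J_left (hJ : IsKahler J) {x : M} (v w : TangentSpace 𝓘(ℝ, E) x) :
    (inner ℝ (J x v) w : ℝ) = - inner ℝ v (J x w) := by
  rw [← hJ.isometry x (J x v) w, hJ.sq, inner_neg_left]

/-- The differential of the one-form dual to `B`, evaluated on the fields `X` and `Y`. -/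
noncomputable def extDual (B X Y : Π x : M, TangentSpace 𝓘(ℝ, E) x) (x : M) : ℝ :=
  inner ℝ (leviCivita B x (X x)) (Y x) - inner ℝ (leviCivita B x (Y x)) (X x)

theorem extDual_eq {B X Y : Π x : M, TangentSpace 𝓘(ℝ, E) x} {x : M} (hB : MDiffAt (T% B) x)
    (hX : MDiffAt (T% X) x) (hY : MDiffAt (T% Y) x) :
    extDual B X Y x = mvfderiv 𝓘(ℝ, E) (fun y => (inner ℝ (B y) (Y y) : ℝ)) x (X x)
      - mvfderiv 𝓘(ℝ, E) (fun y => (inner ℝ (B y) (X y) : ℝ)) x (Y x)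
      - inner ℝ (B x) (mlieBracket 𝓘(ℝ, E) X Y x) := by
  rw [leviCivita_metric hX hB hY, leviCivita_metric hY hB hX, ← leviCivita_sub_swap hX hY,
    inner_sub_right, extDual]
  ring

theorem mvfderiv_extDual {B X Y : Π x : M, TangentSpace 𝓘(ℝ, E) x} {x : M}
    (hB : IsSmoothNear B x) (hX : IsSmoothNear X x) (hY : IsSmoothNear Y x)
    (v : TangentSpace 𝓘(ℝ, E) x) :
    mvfderiv 𝓘(ℝ, E) (extDual B X Y) x v
      = mvfderiv 𝓘(ℝ, E)
          (fun z => mvfderiv 𝓘(ℝ, E) (fun y => (inner ℝ (B y) (Y y) : ℝ)) z (X z)) x v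
      - mvfderiv 𝓘(ℝ, E)
          (fun z => mvfderiv 𝓘(ℝ, E) (fun y => (inner ℝ (B y) (X y) : ℝ)) z (Y z)) x v
      - mvfderiv 𝓘(ℝ, E) (fun y => (inner ℝ (B y) (mlieBracket 𝓘(ℝ, E) X Y y) : ℝ)) x v := by
  have h : extDual B X Y =ᶠ[nhds x] fun z =>
      mvfderiv 𝓘(ℝ, E) (fun y => (inner ℝ (B y) (Y y) : ℝ)) z (X z)
      - mvfderiv 𝓘(ℝ, E) (fun y => (inner ℝ (B y) (X y) : ℝ)) z (Y z)
      - inner ℝ (B z) (mlieBracket 𝓘(ℝ, E) X Y z) := by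
    filter_upwards [hB.eventually_mdiffAt, hX.eventually_mdiffAt, hY.eventually_mdiffAt]
      with y h1 h2 h3
    exact extDual_eq h1 h2 h3
  have d : ∀ {P Q : Π x : M, TangentSpace 𝓘(ℝ, E) x}, IsSmoothNear P x → IsSmoothNear Q x →
      MDiffAt (fun z => mvfderiv 𝓘(ℝ, E) (fun y => (inner ℝ (B y) (P y) : ℝ)) z (Q z)) x :=
    fun hP hQ => (contMDiffAt_mvfderiv_apply (m := ∞) (n := ∞)
      (contMDiffAt_inner hB.self_of_nhds hP.self_of_nhds) hQ.self_of_nhds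
      (by simp)).mdifferentiableAt (by simp)
  have d3 : MDiffAt (fun y => (inner ℝ (B y) (mlieBracket 𝓘(ℝ, E) X Y y) : ℝ)) x :=
    (contMDiffAt_inner hB.self_of_nhds (contMDiffAt_mlieBracket hX.self_of_nhds
      hY.self_of_nhds)).mdifferentiableAt (by simp)
  rw [mvfderiv_congr h]
  have d12 := (d hY hX).sub (d hX hY)
  refine (congrArg (fun L : TangentSpace 𝓘(ℝ, E) x →L[ℝ] ℝ => L v)
    ((mvfderiv_sub d12 d3).trans (congrArg (· - _) (mvfderiv_sub (d hY hX) (d hX hY))))).trans ?_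
  rfl

/-- `d ∘ d = 0` for the one-form dual to `B`. -/
theorem extDual_closed {B X Y Z : Π x : M, TangentSpace 𝓘(ℝ, E) x} {x : M}
    (hB : IsSmoothNear B x) (hX : IsSmoothNear X x) (hY : IsSmoothNear Y x)
    (hZ : IsSmoothNear Z x) :
    mvfderiv 𝓘(ℝ, E) (extDual B X Y) x (Z x) + mvfderiv 𝓘(ℝ, E) (extDual B Y Z) x (X x)
      + mvfderiv 𝓘(ℝ, E) (extDual B Z X) x (Y x)
      - extDual B (mlieBracket 𝓘(ℝ, E) X Y) Z x - extDual B (mlieBracket 𝓘(ℝ, E) Y Z) X x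
      - extDual B (mlieBracket 𝓘(ℝ, E) Z X) Y x = 0 := by
  have br : ∀ {P Q : Π x : M, TangentSpace 𝓘(ℝ, E) x}, IsSmoothNear P x → IsSmoothNear Q x →
      MDiffAt (T% (mlieBracket 𝓘(ℝ, E) P Q)) x := fun hP hQ =>
    (contMDiffAt_mlieBracket hP.self_of_nhds hQ.self_of_nhds).mdifferentiableAt (by simp)
  have fn : ∀ {P : Π x : M, TangentSpace 𝓘(ℝ, E) x}, IsSmoothNear P x →
      ∀ᶠ y in nhds x, CMDiffAt ∞ (fun y => (inner ℝ (B y) (P y) : ℝ)) y := fun hP => by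
    filter_upwards [hB, hP] with y h1 h2
    exact contMDiffAt_inner h1 h2
  have min2 : minSmoothness ℝ 2 ≤ (∞ : WithTop ℕ∞) := by simp; exact ENat.LEInfty.out
  have : IsManifold 𝓘(ℝ, E) (minSmoothness ℝ 3) M := by
    have : minSmoothness ℝ 3 ≤ (∞ : WithTop ℕ∞) := by simp; exact ENat.LEInfty.out
    exact IsManifold.of_le this
  have jac := leibniz_identity_mlieBracket_apply (I := 𝓘(ℝ, E)) (U := X) (V := Y) (W := Z) (x := x)
    (hX.self_of_nhds.of_le min2) (hY.self_of_nhds.of_le min2) (hZ.self_of_nhds.of_le min2)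
  -- The double brackets cancel by this cyclic Jacobi identity; the second derivatives of the
  -- functions `g(B, ·)` cancel by the commutator formula `mvfderiv_mlieBracket`.
  have jac' : mlieBracket 𝓘(ℝ, E) (mlieBracket 𝓘(ℝ, E) X Y) Z x
      + mlieBracket 𝓘(ℝ, E) (mlieBracket 𝓘(ℝ, E) Y Z) X x
      + mlieBracket 𝓘(ℝ, E) (mlieBracket 𝓘(ℝ, E) Z X) Y x = 0 := by
    rw [mlieBracket_swap_apply (V := mlieBracket 𝓘(ℝ, E) Y Z), jac,
      mlieBracket_swap_apply (V := mlieBracket 𝓘(ℝ, E) Z X), mlieBracket_swap (V := Z) (W := X)]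
    have h0 : mlieBracket 𝓘(ℝ, E) Y (-mlieBracket 𝓘(ℝ, E) X Z) x
        = - mlieBracket 𝓘(ℝ, E) Y (mlieBracket 𝓘(ℝ, E) X Z) x := by
      have := mlieBracket_const_smul_right (I := 𝓘(ℝ, E)) (V := Y) (c := (-1 : ℝ)) (br hX hZ)
      simpa using this
    rw [h0]
    abel
  have jac'' := congrArg (fun v => (inner ℝ (B x) v : ℝ)) jac'
  simp only [inner_add_right, inner_zero_right] at jac''
  rw [mvfderiv_extDual hB hX hY, mvfderiv_extDual hB hY hZ, mvfderiv_extDual hB hZ hX,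
    extDual_eq hB.mdiffAt (br hX hY) hZ.mdiffAt, extDual_eq hB.mdiffAt (br hY hZ) hX.mdiffAt,
    extDual_eq hB.mdiffAt (br hZ hX) hY.mdiffAt, mvfderiv_mlieBracket (fn hZ) hX hY,
    mvfderiv_mlieBracket (fn hX) hY hZ, mvfderiv_mlieBracket (fn hY) hZ hX]
  linarith

end LeviCivita

section ComplexLine

/-! ### Linear algebra of a complex line in a Hermitian vector space -/

variable {T : Type*} [NormedAddCommGroup T] [InnerProductSpace ℝ T] {J : T →L[ℝ] T}
  {D : Submodule ℝ T} {A : T} {H : T →L[ℝ] T}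

theorem inner_J_self (hsq : ∀ v, J (J v) = -v) (hiso : ∀ v w, (inner ℝ (J v) (J w) : ℝ) = inner ℝ v w)
    (v : T) : (inner ℝ (J v) v : ℝ) = 0 := by
  have h := hiso (J v) v
  rw [hsq, inner_neg_left, real_inner_comm] at h
  linarith

theorem eq_combination_of_mem (hsq : ∀ v, J (J v) = -v)
    (hiso : ∀ v w, (inner ℝ (J v) (J w) : ℝ) = inner ℝ v w)
    (hrank : Module.finrank ℝ D = 2) (hJD : ∀ v ∈ D, J v ∈ D) (hA : A ≠ 0) (hAD : A ∈ D)
    {v : T} (hv : v ∈ D) :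
    v = (inner ℝ A v / inner ℝ A A : ℝ) • A + (inner ℝ (J A) v / inner ℝ A A : ℝ) • J A := by
  have hN : (inner ℝ A A : ℝ) ≠ 0 := inner_self_ne_zero.2 hA
  have h0 := inner_J_self hsq hiso A
  have h0' : (inner ℝ A (J A) : ℝ) = 0 := by rw [real_inner_comm]; exact h0
  have hli : LinearIndependent ℝ ![A, J A] := by
    rw [LinearIndependent.pair_iff]
    intro s t hst
    have h1 := congrArg (fun w => (inner ℝ A w : ℝ)) hst
    have h2 := congrArg (fun w => (inner ℝ (J A) w : ℝ)) hst
    simp only [inner_add_right, inner_smul_right, h0, h0', hiso, inner_zero_right, mul_zero,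
      add_zero, zero_add, mul_eq_zero, hN, or_false] at h1 h2
    exact ⟨h1, h2⟩
  have : FiniteDimensional ℝ D := Module.finite_of_finrank_pos (by omega)
  have hspan : Submodule.span ℝ {A, J A} = D := by
    refine Submodule.eq_of_le_of_finrank_eq ?_ ?_
    · rw [Submodule.span_le]
      rintro w (rfl | rfl)
      exacts [hAD, hJD _ hAD]
    · have := finrank_span_eq_card hli
      rw [Matrix.range_cons_cons_empty] at this
      rw [this, hrank]
      simp
  rw [← hspan] at hv
  obtain ⟨a, b, rfl⟩ := Submodule.mem_span_pair.1 hv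
  simp only [inner_add_right, inner_smul_right, h0, h0', hiso, mul_zero, add_zero, zero_add,
    mul_div_cancel_right₀ _ hN]

theorem sub_combination_mem_orthogonal (hsq : ∀ v, J (J v) = -v)
    (hiso : ∀ v w, (inner ℝ (J v) (J w) : ℝ) = inner ℝ v w)
    (hrank : Module.finrank ℝ D = 2) (hJD : ∀ v ∈ D, J v ∈ D) (hA : A ≠ 0) (hAD : A ∈ D) (u : T) :
    u - ((inner ℝ A u / inner ℝ A A : ℝ) • A + (inner ℝ (J A) u / inner ℝ A A : ℝ) • J A)
      ∈ Dᗮ := by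
  have hN : (inner ℝ A A : ℝ) ≠ 0 := inner_self_ne_zero.2 hA
  have h0 := inner_J_self hsq hiso A
  have h0' : (inner ℝ A (J A) : ℝ) = 0 := by rw [real_inner_comm]; exact h0
  rw [Submodule.mem_orthogonal]
  intro v hv
  rw [eq_combination_of_mem hsq hiso hrank hJD hA hAD hv]
  simp only [inner_sub_right, inner_add_left, inner_add_right, inner_smul_left, inner_smul_right,
    h0, h0', hiso, conj_trivial]
  field_simp
  ring

theorem J_mem_orthogonal (hsq : ∀ v, J (J v) = -v)
    (hiso : ∀ v w, (inner ℝ (J v) (J w) : ℝ) = inner ℝ v w) (hJD : ∀ v ∈ D, J v ∈ D)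
    {e : T} (he : e ∈ Dᗮ) : J e ∈ Dᗮ := by
  rw [Submodule.mem_orthogonal] at he ⊢
  intro v hv
  rw [← hiso, hsq, inner_neg_right, he _ (hJD v hv), neg_zero]

/-- A symmetric operator preserving `D` preserves `Dᗮ`, so `H e - c • e` lies in `Dᗮ` and may be
tested against itself. -/
theorem apply_eq_smul_of_mem_orthogonal (hsymm : ∀ v w, (inner ℝ (H v) w : ℝ) = inner ℝ v (H w))
    {c : ℝ} (hE : ∀ e ∈ Dᗮ, ∀ f ∈ Dᗮ, (inner ℝ (H e) f : ℝ) = c * inner ℝ e f)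
    (hD : ∀ v ∈ D, H v ∈ D) {e : T} (he : e ∈ Dᗮ) : H e = c • e := by
  have h1 : H e ∈ Dᗮ := by
    rw [Submodule.mem_orthogonal] at he ⊢
    intro v hv
    rw [← hsymm, he _ (hD v hv)]
  have h2 : H e - c • e ∈ Dᗮ := Submodule.sub_mem _ h1 (Submodule.smul_mem _ _ he)
  rw [← sub_eq_zero, ← inner_self_eq_zero (𝕜 := ℝ)]
  conv_lhs => rw [inner_sub_left, inner_smul_left, hE e he _ h2]
  simp

theorem apply_eq_of_diagonal (hsq : ∀ v, J (J v) = -v)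
    (hiso : ∀ v w, (inner ℝ (J v) (J w) : ℝ) = inner ℝ v w)
    (hrank : Module.finrank ℝ D = 2) (hJD : ∀ v ∈ D, J v ∈ D) (hA : A ≠ 0) (hAD : A ∈ D)
    (hsymm : ∀ v w, (inner ℝ (H v) w : ℝ) = inner ℝ v (H w)) (hD : ∀ v ∈ D, H v ∈ D)
    (h1 : (inner ℝ (H A) A : ℝ) + (inner ℝ A A : ℝ) ^ 2 = inner ℝ (H (J A)) (J A))
    (h2 : (inner ℝ (H (J A)) A : ℝ) = 0) :
    H A = (inner ℝ (H A) A / inner ℝ A A : ℝ) • A ∧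
      H (J A) = (inner ℝ (H A) A / inner ℝ A A + inner ℝ A A : ℝ) • J A := by
  have hN : (inner ℝ A A : ℝ) ≠ 0 := inner_self_ne_zero.2 hA
  have e1 := eq_combination_of_mem hsq hiso hrank hJD hA hAD (hD A hAD)
  have e2 := eq_combination_of_mem hsq hiso hrank hJD hA hAD (hD _ (hJD A hAD))
  rw [← hsymm (J A), h2, zero_div, zero_smul, add_zero, ← hsymm A A] at e1
  rw [← real_inner_comm A, h2, zero_div, zero_smul, zero_add,
    ← real_inner_comm (J A), ← h1] at e2
  refine ⟨e1, e2.trans ?_⟩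
  congr 1
  field_simp

/-- The rank-one term shifts the eigenvalue of `A` by `|A|²`, to that of `JA`. The sum is then a
scalar on each of the two `J`-invariant subspaces `D` and `Dᗮ`. -/
theorem add_apply_comm (hsq : ∀ v, J (J v) = -v)
    (hiso : ∀ v w, (inner ℝ (J v) (J w) : ℝ) = inner ℝ v w)
    (hrank : Module.finrank ℝ D = 2) (hJD : ∀ v ∈ D, J v ∈ D) (hA : A ≠ 0) (hAD : A ∈ D)
    {a c : ℝ} (hHA : H A = a • A) (hHJ : H (J A) = (a + inner ℝ A A : ℝ) • J A)
    (hHE : ∀ e ∈ Dᗮ, H e = c • e) (u : T) :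
    (inner ℝ A (J u) : ℝ) • A + H (J u) = J ((inner ℝ A u : ℝ) • A + H u) := by
  have hN : (inner ℝ A A : ℝ) ≠ 0 := inner_self_ne_zero.2 hA
  have he := sub_combination_mem_orthogonal hsq hiso hrank hJD hA hAD u
  have hJe := J_mem_orthogonal hsq hiso hJD he
  have hp : (inner ℝ (J A) u : ℝ) = - inner ℝ A (J u) := by
    rw [← hiso (J A) u, hsq, inner_neg_left]
  set p : ℝ := inner ℝ A u / inner ℝ A A with hp'
  set q : ℝ := inner ℝ (J A) u / inner ℝ A A with hq'
  set e := u - (p • A + q • J A) with hedef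
  have hu : u = p • A + q • J A + e := by rw [hedef]; abel
  have i1 : (inner ℝ A u : ℝ) = p * inner ℝ A A := by rw [hp']; field_simp
  have i2 : (inner ℝ A (J u) : ℝ) = - (q * inner ℝ A A) := by
    rw [hq', hp]; field_simp
  rw [i1, i2]
  conv_lhs => rw [hu]
  conv_rhs => rw [hu]
  simp only [map_add, map_smul, hsq, hHA, hHJ, hHE e he, hHE _ hJe, map_neg, smul_neg]
  module

end ComplexLine

/-! ### The dual field `A` of `α` and the identity obtained from `d ∘ d = 0` -/

section Foliation

set_option linter.unusedSectionVars false

variable {E : Type*} [NormedAddCommGroup E] [NormedSpace ℝ E] [FiniteDimensional ℝ E]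
  {M : Type*} [TopologicalSpace M] [ChartedSpace E M] [IsManifold 𝓘(ℝ, E) ∞ M]
  [RiemannianBundle (fun x : M => TangentSpace 𝓘(ℝ, E) x)]
  [IsContMDiffRiemannianBundle 𝓘(ℝ, E) ∞ E (fun x : M => TangentSpace 𝓘(ℝ, E) x)]

/-- A totally geodesic homothetic foliation by complex curves of a Kähler manifold. -/
structure IsHomotheticKahlerFoliation
    (J : Π x : M, TangentSpace 𝓘(ℝ, E) x →L[ℝ] TangentSpace 𝓘(ℝ, E) x)
    (D : Π x : M, Submodule ℝ (TangentSpace 𝓘(ℝ, E) x))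
    (α : Π x : M, TangentSpace 𝓘(ℝ, E) x →L[ℝ] ℝ) : Prop where
  kahler : IsKahler J
  foliation : IsComplexFoliation J D
  geodesic : IsTotallyGeodesic D
  homothetic : IsHomotheticFoliation D α

/-- The vector field dual to a one-form. -/
noncomputable def dualField (α : Π x : M, TangentSpace 𝓘(ℝ, E) x →L[ℝ] ℝ) (x : M) :
    TangentSpace 𝓘(ℝ, E) x :=
  sharp (α x)

theorem inner_dualField (α : Π x : M, TangentSpace 𝓘(ℝ, E) x →L[ℝ] ℝ) (x : M)
    (v : TangentSpace 𝓘(ℝ, E) x) : (inner ℝ (dualField α x) v : ℝ) = α x v :=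
  inner_sharp _ _

theorem dualField_eq_zero_iff {α : Π x : M, TangentSpace 𝓘(ℝ, E) x →L[ℝ] ℝ} {x : M} :
    dualField α x = 0 ↔ α x = 0 := by
  constructor
  · intro h
    ext v
    rw [← inner_dualField, h]
    simp
  · intro h
    exact ext_inner_right ℝ fun v => by rw [inner_dualField, h]; simp

namespace IsHomotheticKahlerFoliation

variable {J : Π x : M, TangentSpace 𝓘(ℝ, E) x →L[ℝ] TangentSpace 𝓘(ℝ, E) x}
  {D : Π x : M, Submodule ℝ (TangentSpace 𝓘(ℝ, E) x)}
  {α : Π x : M, TangentSpace 𝓘(ℝ, E) x →L[ℝ] ℝ}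

theorem dualField_mem (h : IsHomotheticKahlerFoliation J D α) (x : M) : dualField α x ∈ D x := by
  have : FiniteDimensional ℝ (TangentSpace 𝓘(ℝ, E) x) := inferInstanceAs (FiniteDimensional ℝ E)
  rw [← Submodule.orthogonal_orthogonal (D x), Submodule.mem_orthogonal']
  intro v hv
  rw [inner_dualField, h.homothetic.vanishes x v hv]

theorem contMDiffAt_dualField (h : IsHomotheticKahlerFoliation J D α) (x : M) :
    CMDiffAt ∞ (T% (dualField α)) x :=
  contMDiffAt_sharp h.homothetic.smooth x

theorem isSmoothNear_dualField (h : IsHomotheticKahlerFoliation J D α) (x : M) :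
    IsSmoothNear (dualField α) x :=
  Filter.Eventually.of_forall h.contMDiffAt_dualField

theorem mdiffAt_dualField (h : IsHomotheticKahlerFoliation J D α) (x : M) :
    MDiffAt (T% (dualField α)) x := (h.isSmoothNear_dualField x).mdiffAt

theorem isSectionOn_dualField (h : IsHomotheticKahlerFoliation J D α) :
    IsSectionOn D Set.univ (dualField α) :=
  ⟨fun x _ => (h.contMDiffAt_dualField x).contMDiffWithinAt, fun x _ => h.dualField_mem x⟩

theorem isSectionOn_J_dualField (h : IsHomotheticKahlerFoliation J D α) :
    IsSectionOn D Set.univ (fun y => J y (dualField α y)) :=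
  ⟨fun x _ => (h.kahler.contMDiffAt (h.contMDiffAt_dualField x)).contMDiffWithinAt,
    fun x _ => h.foliation.complex x _ (h.dualField_mem x)⟩

/-- The skew part of `∇A` is, up to a factor, `dα = 0`. -/
theorem nabla_symm (h : IsHomotheticKahlerFoliation J D α) {x : M}
    (v w : TangentSpace 𝓘(ℝ, E) x) :
    (inner ℝ (leviCivita (dualField α) x v) w : ℝ) = inner ℝ v (leviCivita (dualField α) x w) := by
  obtain ⟨X, hX, rfl⟩ := exists_isSmoothNear x v
  obtain ⟨Y, hY, rfl⟩ := exists_isSmoothNear x w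
  have hA := h.mdiffAt_dualField x
  have h1 := extDual_eq hA hX.mdiffAt hY.mdiffAt
  simp only [inner_dualField] at h1
  rw [h.homothetic.closed x X Y hX.mdiffAt hY.mdiffAt, extDual, sub_eq_zero] at h1
  rw [h1, real_inner_comm]

/-- By symmetry `L_A g` is twice the form of `∇A`, while the homothetic condition makes it `α(A) g =
|A|² g` on `Dᗮ`; hence the factor `1/2`. -/
theorem nabla_orthogonal_form (h : IsHomotheticKahlerFoliation J D α) {x : M}
    {e f : TangentSpace 𝓘(ℝ, E) x} (he : e ∈ (D x)ᗮ) (hf : f ∈ (D x)ᗮ) :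
    (inner ℝ (leviCivita (dualField α) x e) f : ℝ)
      = (inner ℝ (dualField α x) (dualField α x) / 2 : ℝ) * inner ℝ e f := by
  obtain ⟨X, hX, rfl⟩ := exists_isSmoothNear x e
  obtain ⟨Y, hY, rfl⟩ := exists_isSmoothNear x f
  have h1 := h.homothetic.conformal Set.univ isOpen_univ (dualField α) h.isSectionOn_dualField x
    trivial X Y hX.mdiffAt hY.mdiffAt he hf
  rw [lieDerivMetric_eq (h.mdiffAt_dualField x) hX.mdiffAt hY.mdiffAt, ← h.nabla_symm,
    ← inner_dualField] at h1
  linarith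

/-- Where `α` is nonzero, `A` and `JA` are sections spanning `D`, so total geodesy need only be
applied to them. -/
theorem nabla_mem (h : IsHomotheticKahlerFoliation J D α) {x : M} (hx : α x ≠ 0)
    {v : TangentSpace 𝓘(ℝ, E) x} (hv : v ∈ D x) : leviCivita (dualField α) x v ∈ D x := by
  rw [eq_combination_of_mem (h.kahler.sq x) (h.kahler.isometry x) (h.foliation.rank_two x)
    (h.foliation.complex x) (mt dualField_eq_zero_iff.1 hx) (h.dualField_mem x) hv, map_add,
    map_smul, map_smul]
  exact Submodule.add_mem _
    (Submodule.smul_mem _ _ (h.geodesic Set.univ isOpen_univ _ _ h.isSectionOn_dualField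
      h.isSectionOn_dualField x trivial))
    (Submodule.smul_mem _ _ (h.geodesic Set.univ isOpen_univ _ _ h.isSectionOn_J_dualField
      h.isSectionOn_dualField x trivial))

theorem nabla_orthogonal (h : IsHomotheticKahlerFoliation J D α) {x : M} (hx : α x ≠ 0)
    {e : TangentSpace 𝓘(ℝ, E) x} (he : e ∈ (D x)ᗮ) :
    leviCivita (dualField α) x e = (inner ℝ (dualField α x) (dualField α x) / 2 : ℝ) • e :=
  apply_eq_smul_of_mem_orthogonal (H := leviCivita (dualField α) x) h.nabla_symm
    (fun _ he _ hf => h.nabla_orthogonal_form he hf) (fun _ hv => h.nabla_mem hx hv) he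

theorem eventually_ne_zero (h : IsHomotheticKahlerFoliation J D α) {x : M} (hx : α x ≠ 0) :
    ∀ᶠ y in nhds x, α y ≠ 0 := by
  have hc : ContinuousAt (fun y => (inner ℝ (dualField α y) (dualField α y) : ℝ)) x :=
    (contMDiffAt_inner (h.contMDiffAt_dualField x) (h.contMDiffAt_dualField x)).continuousAt
  have hne : (inner ℝ (dualField α x) (dualField α x) : ℝ) ≠ 0 :=
    inner_self_ne_zero.2 (mt dualField_eq_zero_iff.1 hx)
  filter_upwards [hc.eventually_ne hne] with y hy hy0
  exact hy (inner_self_eq_zero.2 (dualField_eq_zero_iff.2 hy0))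

/-- Over the set where `α` is nonzero, orthogonal vectors extend to orthogonal fields. -/
theorem exists_orthogonal_field (h : IsHomotheticKahlerFoliation J D α) {x : M} (hx : α x ≠ 0)
    {e : TangentSpace 𝓘(ℝ, E) x} (he : e ∈ (D x)ᗮ) :
    ∃ X : Π x : M, TangentSpace 𝓘(ℝ, E) x, IsSmoothNear X x ∧ X x = e ∧
      ∀ᶠ y in nhds x, X y ∈ (D y)ᗮ := by
  obtain ⟨Z, hZ, rfl⟩ := exists_isSmoothNear x e
  let A := dualField α
  let B : Π x : M, TangentSpace 𝓘(ℝ, E) x := fun y => J y (A y)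
  let N : M → ℝ := fun y => inner ℝ (A y) (A y)
  -- The orthogonal projection of `Z` to `D`, in the orthogonal frame `A`, `JA` of vectors of equal
  -- length; it is smooth only where `A ≠ 0`.
  let P : Π x : M, TangentSpace 𝓘(ℝ, E) x :=
    fun y => (inner ℝ (A y) (Z y) / N y : ℝ) • A y + (inner ℝ (B y) (Z y) / N y : ℝ) • B y
  have hA : ∀ y, CMDiffAt ∞ (T% A) y := h.contMDiffAt_dualField
  have hB : ∀ y, CMDiffAt ∞ (T% B) y := fun y => h.kahler.contMDiffAt (hA y)
  refine ⟨fun y => Z y - P y, ?_, ?_, ?_⟩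
  · filter_upwards [hZ, h.eventually_ne_zero hx] with y hZy hy
    have hN : N y ≠ 0 := inner_self_ne_zero.2 (mt dualField_eq_zero_iff.1 hy)
    have hNs : CMDiffAt ∞ N y := contMDiffAt_inner (hA y) (hA y)
    have c1 : CMDiffAt ∞ (fun y => (inner ℝ (A y) (Z y) / N y : ℝ)) y :=
      (contMDiffAt_inner (hA y) hZy).div₀ hNs hN
    have c2 : CMDiffAt ∞ (fun y => (inner ℝ (B y) (Z y) / N y : ℝ)) y :=
      (contMDiffAt_inner (hB y) hZy).div₀ hNs hN
    exact hZy.sub_section ((c1.smul_section (hA y)).add_section (c2.smul_section (hB y)))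
  · have h1 : (inner ℝ (A x) (Z x) : ℝ) = 0 := (Submodule.mem_orthogonal _ _).1 he _ (h.dualField_mem x)
    have h2 : (inner ℝ (B x) (Z x) : ℝ) = 0 :=
      (Submodule.mem_orthogonal _ _).1 he _ (h.foliation.complex x _ (h.dualField_mem x))
    simp [P, h1, h2]
  · filter_upwards [h.eventually_ne_zero hx] with y hy
    exact sub_combination_mem_orthogonal (h.kahler.sq y) (h.kahler.isometry y)
      (h.foliation.rank_two y) (h.foliation.complex y) (mt dualField_eq_zero_iff.1 hy)
      (h.dualField_mem y) (Z y)

theorem J_mem_orthogonal' (h : IsHomotheticKahlerFoliation J D α) {x : M}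
    {e : TangentSpace 𝓘(ℝ, E) x} (he : e ∈ (D x)ᗮ) : J x e ∈ (D x)ᗮ :=
  J_mem_orthogonal (h.kahler.sq x) (h.kahler.isometry x) (h.foliation.complex x) he

/-- The consequence of `d ∘ d = 0` for the one-form dual to `J A`, where `A` is dual to `α`. -/
theorem closed_identity (h : IsHomotheticKahlerFoliation J D α) {x : M} (hx : α x ≠ 0)
    {X V : Π x : M, TangentSpace 𝓘(ℝ, E) x} (hX : IsSmoothNear X x)
    (hXD : ∀ᶠ y in nhds x, X y ∈ (D y)ᗮ) (hV : IsSmoothNear V x)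
    (hVD : ∀ᶠ y in nhds x, V y ∈ D y) :
    mvfderiv 𝓘(ℝ, E) (fun y => (inner ℝ (dualField α y) (dualField α y) : ℝ)) x (V x)
        * inner ℝ (X x) (X x)
      + inner ℝ (dualField α x) (dualField α x)
        * (inner ℝ (leviCivita V x (X x)) (X x)
          + inner ℝ (leviCivita V x (J x (X x))) (J x (X x)))
      + inner ℝ (mlieBracket 𝓘(ℝ, E) X (fun y => J y (X y)) x)
        (J x (leviCivita (dualField α) x (V x)) + leviCivita (dualField α) x (J x (V x))) = 0 := by
  set A := dualField α with hAdef
  let B : Π x : M, TangentSpace 𝓘(ℝ, E) x := fun y => J y (A y)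
  let Y : Π x : M, TangentSpace 𝓘(ℝ, E) x := fun y => J y (X y)
  have hA : IsSmoothNear A x := h.isSmoothNear_dualField x
  have hB : IsSmoothNear B x := h.kahler.isSmoothNear hA
  have hY : IsSmoothNear Y x := h.kahler.isSmoothNear hX
  have hnB : ∀ y u, leviCivita B y u = J y (leviCivita A y u) := fun y u =>
    h.kahler.parallel A y (h.mdiffAt_dualField y) u
  have hne := h.eventually_ne_zero hx
  have orth : ∀ {y : M} {v e : TangentSpace 𝓘(ℝ, E) y}, v ∈ D y → e ∈ (D y)ᗮ →
      (inner ℝ v e : ℝ) = 0 := fun hv he => (Submodule.mem_orthogonal _ _).1 he _ hv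
  -- `∇A` and `J` both preserve the splitting, so the two-form `d g(JA, ·)` has no mixed component.
  -- Among the derivative terms of `d ∘ d = 0` only that of `|A|²|X|²`, its value on `X, JX`,
  -- remains.
  have Ω0 : ∀ {y : M} {v e : TangentSpace 𝓘(ℝ, E) y}, α y ≠ 0 → v ∈ D y → e ∈ (D y)ᗮ →
      (inner ℝ (leviCivita B y v) e : ℝ) = 0 ∧ (inner ℝ (leviCivita B y e) v : ℝ) = 0 := by
    intro y v e hy hv he
    constructor
    · rw [hnB]
      exact orth (h.foliation.complex y _ (h.nabla_mem hy hv)) he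
    · rw [hnB, h.nabla_orthogonal hy he, real_inner_comm]
      exact orth hv (h.J_mem_orthogonal' (Submodule.smul_mem _ _ he))
  have hYV : extDual B Y V =ᶠ[nhds x] fun _ => 0 := by
    filter_upwards [hne, hXD, hVD] with y hy hXy hVy
    obtain ⟨h1, h2⟩ := Ω0 hy hVy (h.J_mem_orthogonal' hXy)
    rw [extDual, h1, h2, sub_zero]
  have hVX : extDual B V X =ᶠ[nhds x] fun _ => 0 := by
    filter_upwards [hne, hXD, hVD] with y hy hXy hVy
    obtain ⟨h1, h2⟩ := Ω0 hy hVy hXy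
    rw [extDual, h1, h2, sub_zero]
  have hXY : extDual B X Y =ᶠ[nhds x] fun y => (inner ℝ (A y) (A y) : ℝ) * inner ℝ (X y) (X y) := by
    filter_upwards [hne, hXD] with y hy hXy
    simp only [extDual, hnB, Y]
    rw [h.nabla_orthogonal hy hXy, h.nabla_orthogonal hy (h.J_mem_orthogonal' hXy),
      map_smul, map_smul, inner_smul_left, h.kahler.isometry, h.kahler.sq, inner_smul_left,
      inner_neg_left]
    simp only [conj_trivial]
    ring
  have hcl := extDual_closed hB hX hY hV
  have dA : MDiffAt (fun y => (inner ℝ (A y) (A y) : ℝ)) x := mdiffAt_inner hA.mdiffAt hA.mdiffAt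
  have dX : MDiffAt (fun y => (inner ℝ (X y) (X y) : ℝ)) x := mdiffAt_inner hX.mdiffAt hX.mdiffAt
  rw [mvfderiv_congr hYV, mvfderiv_congr hVX, mvfderiv_congr hXY, mvfderiv_const,
    mvfderiv_fun_mul dA dX] at hcl
  have hXx := hXD.self_of_nhds
  have hYx : J x (X x) ∈ (D x)ᗮ := h.J_mem_orthogonal' hXx
  have bYV : mlieBracket 𝓘(ℝ, E) Y V x = - mlieBracket 𝓘(ℝ, E) V Y x := mlieBracket_swap_apply
  have e1 : extDual B (mlieBracket 𝓘(ℝ, E) V X) Y x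
      = inner ℝ (A x) (A x) * inner ℝ (mlieBracket 𝓘(ℝ, E) V X x) (X x) := by
    simp only [extDual, hnB, Y]
    rw [h.kahler.isometry, h.nabla_symm, h.nabla_orthogonal hx hXx, h.nabla_orthogonal hx hYx,
      map_smul, h.kahler.sq, inner_smul_left, inner_smul_right, inner_neg_left,
      real_inner_comm (mlieBracket 𝓘(ℝ, E) V X x) (X x)]
    simp only [conj_trivial]
    ring
  have e2 : extDual B (mlieBracket 𝓘(ℝ, E) Y V) X x
      = inner ℝ (A x) (A x) * inner ℝ (mlieBracket 𝓘(ℝ, E) V Y x) (Y x) := by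
    simp only [extDual, hnB, Y]
    rw [bYV, h.kahler.inner_J_left, h.nabla_symm, h.nabla_orthogonal hx hXx,
      h.nabla_orthogonal hx hYx,
      map_smul, inner_smul_left, inner_smul_right, inner_neg_left, inner_neg_right,
      real_inner_comm (J x (X x))]
    simp only [conj_trivial, Y]
    ring
  have e3 : extDual B (mlieBracket 𝓘(ℝ, E) X Y) V x
      = - inner ℝ (mlieBracket 𝓘(ℝ, E) X Y x)
        (J x (leviCivita A x (V x)) + leviCivita A x (J x (V x))) := by
    simp only [extDual, hnB]
    rw [h.kahler.inner_J_left, h.nabla_symm, inner_add_right,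
      real_inner_comm (mlieBracket 𝓘(ℝ, E) X Y x)]
    ring
  have e4 : (inner ℝ (mlieBracket 𝓘(ℝ, E) V X x) (X x) : ℝ)
      = inner ℝ (leviCivita X x (V x)) (X x) - inner ℝ (leviCivita V x (X x)) (X x) := by
    rw [← leviCivita_sub_swap hV.mdiffAt hX.mdiffAt, inner_sub_left]
  have e5 : (inner ℝ (mlieBracket 𝓘(ℝ, E) V Y x) (Y x) : ℝ)
      = inner ℝ (leviCivita X x (V x)) (X x)
        - inner ℝ (leviCivita V x (J x (X x))) (J x (X x)) := by
    rw [← leviCivita_sub_swap hV.mdiffAt hY.mdiffAt, inner_sub_left,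
      h.kahler.parallel X x hX.mdiffAt]
    simp only [Y]
    rw [h.kahler.isometry]
  have e6 : mvfderiv 𝓘(ℝ, E) (fun y => (inner ℝ (X y) (X y) : ℝ)) x (V x)
      = 2 * inner ℝ (leviCivita X x (V x)) (X x) := by
    rw [leviCivita_metric hV.mdiffAt hX.mdiffAt hX.mdiffAt, real_inner_comm]
    ring
  rw [e1, e2, e3, e4, e5] at hcl
  simp only [add_apply, smul_apply, zero_apply, smul_eq_mul, e6] at hcl
  linarith

end IsHomotheticKahlerFoliation

end Foliation

section Structure

set_option linter.unusedSectionVars false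

variable {E : Type*} [NormedAddCommGroup E] [NormedSpace ℝ E] [FiniteDimensional ℝ E]
  {M : Type*} [TopologicalSpace M] [ChartedSpace E M] [IsManifold 𝓘(ℝ, E) ∞ M]
  [RiemannianBundle (fun x : M => TangentSpace 𝓘(ℝ, E) x)]
  [IsContMDiffRiemannianBundle 𝓘(ℝ, E) ∞ E (fun x : M => TangentSpace 𝓘(ℝ, E) x)]

namespace IsHomotheticKahlerFoliation

variable {J : Π x : M, TangentSpace 𝓘(ℝ, E) x →L[ℝ] TangentSpace 𝓘(ℝ, E) x}
  {D : Π x : M, Submodule ℝ (TangentSpace 𝓘(ℝ, E) x)}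
  {α : Π x : M, TangentSpace 𝓘(ℝ, E) x →L[ℝ] ℝ}

/-! ### The structure of the covariant derivative of the dual field -/

theorem nabla_J_dualField (h : IsHomotheticKahlerFoliation J D α) (x : M)
    (u : TangentSpace 𝓘(ℝ, E) x) :
    leviCivita (fun y => J y (dualField α y)) x u = J x (leviCivita (dualField α) x u) :=
  h.kahler.parallel _ x (h.mdiffAt_dualField x) u

/-- If `⟪X, V⟫` vanishes near `x`, then `⟪∇_u X, V⟫ = - ⟪X, ∇_u V⟫` at `x`. -/
theorem inner_nabla_of_orthogonal {X V : Π x : M, TangentSpace 𝓘(ℝ, E) x} {x : M}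
    (hX : MDiffAt (T% X) x) (hV : MDiffAt (T% V) x) (hXD : ∀ᶠ y in nhds x, X y ∈ (D y)ᗮ)
    (hVD : ∀ y, V y ∈ D y) (u : TangentSpace 𝓘(ℝ, E) x) :
    (inner ℝ (leviCivita X x u) (V x) : ℝ) = - inner ℝ (X x) (leviCivita V x u) := by
  obtain ⟨Z, hZ, rfl⟩ := exists_isSmoothNear x u
  have h0 : (fun y => (inner ℝ (X y) (V y) : ℝ)) =ᶠ[nhds x] fun _ => 0 := by
    filter_upwards [hXD] with y hy
    exact (Submodule.mem_orthogonal' _ _).1 hy _ (hVD y)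
  have h1 := leviCivita_metric hZ.mdiffAt hX hV
  rw [mvfderiv_congr h0, mvfderiv_const] at h1
  simp only [zero_apply] at h1
  linarith

/-- The bracket is `J ∇_X X - ∇_{JX} X`. Its products with `A` and `JA` are moved by metricity onto
`∇A` and `J∇A`, which are known on `Dᗮ`. -/
theorem inner_mlieBracket_J (h : IsHomotheticKahlerFoliation J D α) {x : M} (hx : α x ≠ 0)
    {X : Π x : M, TangentSpace 𝓘(ℝ, E) x} (hX : IsSmoothNear X x)
    (hXD : ∀ᶠ y in nhds x, X y ∈ (D y)ᗮ) {z : TangentSpace 𝓘(ℝ, E) x} (hz : z ∈ D x) :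
    (inner ℝ (mlieBracket 𝓘(ℝ, E) X (fun y => J y (X y)) x) z : ℝ)
      = - (inner ℝ (J x (dualField α x)) z * inner ℝ (X x) (X x)) := by
  have hN : (inner ℝ (dualField α x) (dualField α x) : ℝ) ≠ 0 :=
    inner_self_ne_zero.2 (mt dualField_eq_zero_iff.1 hx)
  have hXx := hXD.self_of_nhds
  have iA : ∀ u, (inner ℝ (leviCivita X x u) (dualField α x) : ℝ)
      = - (inner ℝ (dualField α x) (dualField α x) / 2 * inner ℝ (X x) u) := fun u => by
    rw [inner_nabla_of_orthogonal hX.mdiffAt (h.mdiffAt_dualField x) hXD h.dualField_mem,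
      ← h.nabla_symm, h.nabla_orthogonal hx hXx, inner_smul_left, conj_trivial]
  have iB : ∀ u, (inner ℝ (leviCivita X x u) (J x (dualField α x)) : ℝ)
      = inner ℝ (dualField α x) (dualField α x) / 2 * inner ℝ (J x (X x)) u := fun u => by
    have := inner_nabla_of_orthogonal hX.mdiffAt (h.kahler.mdiffAt (h.mdiffAt_dualField x)) hXD
      (fun y => h.foliation.complex y _ (h.dualField_mem y)) u
    rw [this, h.nabla_J_dualField, ← h.kahler.inner_J_left, ← h.nabla_symm,
      h.nabla_orthogonal hx (h.J_mem_orthogonal' hXx), inner_smul_left, conj_trivial]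
  have i0 := inner_J_self (h.kahler.sq x) (h.kahler.isometry x) (X x)
  have hw := leviCivita_sub_swap hX.mdiffAt (h.kahler.mdiffAt hX.mdiffAt)
  rw [h.kahler.parallel X x hX.mdiffAt] at hw
  rw [← hw]
  conv_lhs => rw [eq_combination_of_mem (h.kahler.sq x) (h.kahler.isometry x)
    (h.foliation.rank_two x) (h.foliation.complex x) (mt dualField_eq_zero_iff.1 hx)
    (h.dualField_mem x) hz]
  rw [inner_add_right, inner_smul_right, inner_smul_right, inner_sub_left, inner_sub_left,
    h.kahler.inner_J_left, h.kahler.isometry, iA, iA, iB, iB, h.kahler.isometry, i0,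
    real_inner_comm (J x (X x)) (X x), i0]
  field_simp
  ring

theorem mvfderiv_inner_dualField (h : IsHomotheticKahlerFoliation J D α) (x : M)
    (u : TangentSpace 𝓘(ℝ, E) x) :
    mvfderiv 𝓘(ℝ, E) (fun y => (inner ℝ (dualField α y) (dualField α y) : ℝ)) x u
      = 2 * inner ℝ (leviCivita (dualField α) x u) (dualField α x) := by
  obtain ⟨Z, hZ, rfl⟩ := exists_isSmoothNear x u
  rw [leviCivita_metric hZ.mdiffAt (h.mdiffAt_dualField x) (h.mdiffAt_dualField x),
    real_inner_comm (leviCivita (dualField α) x (Z x))]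
  ring

theorem exists_ne_zero_mem_orthogonal (h : IsHomotheticKahlerFoliation J D α)
    (hdim : 2 < Module.finrank ℝ E) (x : M) : ∃ e ∈ (D x)ᗮ, e ≠ 0 := by
  have : FiniteDimensional ℝ (TangentSpace 𝓘(ℝ, E) x) := inferInstanceAs (FiniteDimensional ℝ E)
  have h1 := (D x).finrank_add_finrank_orthogonal
  have h2 : Module.finrank ℝ (TangentSpace 𝓘(ℝ, E) x) = Module.finrank ℝ E := rfl
  rw [h.foliation.rank_two x, h2] at h1
  refine (Submodule.ne_bot_iff _).1 fun h0 => ?_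
  rw [h0, finrank_bot] at h1
  omega

/-- The eigenvalues of the covariant derivative of the dual field on the leaves. -/
theorem nabla_diagonal (h : IsHomotheticKahlerFoliation J D α) (hdim : 2 < Module.finrank ℝ E)
    {x : M} (hx : α x ≠ 0) : ∃ a : ℝ, leviCivita (dualField α) x (dualField α x) = a • dualField α x ∧
      leviCivita (dualField α) x (J x (dualField α x))
        = (a + inner ℝ (dualField α x) (dualField α x) : ℝ) • J x (dualField α x) := by
  obtain ⟨e, he, he0⟩ := h.exists_ne_zero_mem_orthogonal hdim x
  obtain ⟨X, hX, rfl, hXD⟩ := h.exists_orthogonal_field hx he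
  have hX0 : (inner ℝ (X x) (X x) : ℝ) ≠ 0 := inner_self_ne_zero.2 he0
  have i0 := inner_J_self (h.kahler.sq x) (h.kahler.isometry x) (X x)
  have hJX := h.J_mem_orthogonal' he
  have hAD := h.dualField_mem x
  have hBD := h.foliation.complex x _ hAD
  have nD : ∀ {v}, v ∈ D x → leviCivita (dualField α) x v ∈ D x := fun hv => h.nabla_mem hx hv
  -- With `H = ∇A`, the choice `V = A` gives `⟪HA, A⟫ + |A|⁴ = ⟪H(JA), JA⟫` and `V = JA` gives
  -- `⟪H(JA), A⟫ = 0`, both multiplied by `|X|² ≠ 0`.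
  have c1 := h.closed_identity hx hX hXD (h.isSmoothNear_dualField x)
    (Filter.Eventually.of_forall h.dualField_mem)
  have c2 := h.closed_identity hx hX hXD (h.kahler.isSmoothNear (h.isSmoothNear_dualField x))
    (Filter.Eventually.of_forall fun y => h.foliation.complex y _ (h.dualField_mem y))
  rw [h.mvfderiv_inner_dualField, h.inner_mlieBracket_J hx hX hXD (Submodule.add_mem _
    (h.foliation.complex x _ (nD hAD)) (nD hBD)), h.nabla_orthogonal hx he,
    h.nabla_orthogonal hx hJX, inner_smul_left, inner_smul_left, h.kahler.isometry,
    inner_add_right, h.kahler.isometry, real_inner_comm (leviCivita (dualField α) x (dualField α x)),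
    real_inner_comm (leviCivita (dualField α) x (J x (dualField α x)))] at c1
  rw [h.mvfderiv_inner_dualField, h.nabla_J_dualField, h.nabla_J_dualField,
    h.inner_mlieBracket_J hx hX hXD (Submodule.add_mem _
    (h.foliation.complex x _ (nD hBD)) (nD (h.foliation.complex x _ hBD))),
    h.nabla_orthogonal hx he, h.nabla_orthogonal hx hJX, map_smul, map_smul, inner_smul_left,
    inner_smul_left, h.kahler.isometry, i0,
    inner_add_right, h.kahler.isometry, h.kahler.sq, map_neg, inner_neg_right,
    ← h.nabla_symm (J x (dualField α x)),
    real_inner_comm (leviCivita (dualField α) x (J x (dualField α x)))] at c2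
  simp only [conj_trivial] at c1 c2
  refine ⟨_, apply_eq_of_diagonal (H := leviCivita (dualField α) x) (h.kahler.sq x)
    (h.kahler.isometry x) (h.foliation.rank_two x) (h.foliation.complex x)
    (mt dualField_eq_zero_iff.1 hx) hAD h.nabla_symm (fun _ hv => nD hv) ?_ ?_⟩
  · apply mul_right_cancel₀ hX0
    linarith
  · apply mul_right_cancel₀ hX0
    linarith

/-- The tensor `α ⊗ A + ∇ A`, where `A` is dual to `α`, commutes with `J` where `α`
is nonzero. -/
theorem smul_add_nabla_comm_of_ne_zero (h : IsHomotheticKahlerFoliation J D α)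
    (hdim : 2 < Module.finrank ℝ E) {x : M} (hx : α x ≠ 0) (u : TangentSpace 𝓘(ℝ, E) x) :
    α x (J x u) • dualField α x + leviCivita (dualField α) x (J x u)
      = J x (α x u • dualField α x + leviCivita (dualField α) x u) := by
  obtain ⟨a, ha, hJa⟩ := h.nabla_diagonal hdim hx
  rw [← inner_dualField, ← inner_dualField]
  exact add_apply_comm (H := leviCivita (dualField α) x) (h.kahler.sq x) (h.kahler.isometry x)
    (h.foliation.rank_two x) (h.foliation.complex x) (mt dualField_eq_zero_iff.1 hx)
    (h.dualField_mem x) ha hJa (fun _ he => h.nabla_orthogonal hx he) u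

end IsHomotheticKahlerFoliation

end Structure

/-! ### Commutation with `J` on all of `M`, and the field `e^φ J A` -/

section SpecialField

set_option linter.unusedSectionVars false

variable {E : Type*} [NormedAddCommGroup E] [NormedSpace ℝ E] [FiniteDimensional ℝ E]
  {M : Type*} [TopologicalSpace M] [ChartedSpace E M] [IsManifold 𝓘(ℝ, E) ∞ M]

theorem mvfderiv_real_comp {ρ : ℝ → ℝ} {f : M → ℝ} {x : M} {c : ℝ}
    (hρ : HasDerivAt ρ c (f x)) (hf : MDiffAt f x) (u : TangentSpace 𝓘(ℝ, E) x) :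
    mvfderiv 𝓘(ℝ, E) (fun y => ρ (f y)) x u = c * mvfderiv 𝓘(ℝ, E) f x u := by
  have h1 := mvfderiv_comp_apply x hρ.differentiableAt.mdifferentiableAt hf u
  have h2 : mfderiv 𝓘(ℝ, ℝ) 𝓘(ℝ, ℝ) ρ (f x) = ContinuousLinearMap.toSpanSingleton ℝ c :=
    mfderiv_eq_fderiv.trans hρ.hasFDerivAt.fderiv
  have h3 : mvfderiv 𝓘(ℝ, ℝ) ρ (f x) (mfderiv 𝓘(ℝ, E) 𝓘(ℝ, ℝ) f x u)
      = ContinuousLinearMap.toSpanSingleton ℝ c (mvfderiv 𝓘(ℝ, E) f x u) :=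
    congrArg (fun L : ℝ →L[ℝ] ℝ => L (mvfderiv 𝓘(ℝ, E) f x u)) h2
  rw [mul_comm]
  exact h1.trans h3

variable [RiemannianBundle (fun x : M => TangentSpace 𝓘(ℝ, E) x)]
  [IsContMDiffRiemannianBundle 𝓘(ℝ, E) ∞ E (fun x : M => TangentSpace 𝓘(ℝ, E) x)]

/-- A field that vanishes near a point has zero covariant derivative there. -/
theorem leviCivita_eq_zero_of_eventually {X : Π x : M, TangentSpace 𝓘(ℝ, E) x} {x : M}
    (hX : MDiffAt (T% X) x) (h0 : ∀ᶠ y in nhds x, X y = 0) (u : TangentSpace 𝓘(ℝ, E) x) :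
    leviCivita X x u = 0 := by
  obtain ⟨Z, hZ, rfl⟩ := exists_isSmoothNear x u
  refine ext_inner_right ℝ fun w => ?_
  obtain ⟨W, hW, rfl⟩ := exists_isSmoothNear x w
  have h1 := leviCivita_metric hZ.mdiffAt hX hW.mdiffAt
  have h2 : (fun y => (inner ℝ (X y) (W y) : ℝ)) =ᶠ[nhds x] fun _ => 0 := by
    filter_upwards [h0] with y hy
    rw [hy, inner_zero_left]
  rw [mvfderiv_congr h2, mvfderiv_const, h0.self_of_nhds, inner_zero_left] at h1
  rw [inner_zero_left]
  simpa using h1.symm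

namespace IsHomotheticKahlerFoliation

variable {J : Π x : M, TangentSpace 𝓘(ℝ, E) x →L[ℝ] TangentSpace 𝓘(ℝ, E) x}
  {D : Π x : M, Submodule ℝ (TangentSpace 𝓘(ℝ, E) x)}
  {α : Π x : M, TangentSpace 𝓘(ℝ, E) x →L[ℝ] ℝ}

/-- Symmetry of `∇A` turns the form into half of `L_A g`, which is built from brackets and
derivatives of smooth data. -/
theorem continuousAt_inner_nabla (h : IsHomotheticKahlerFoliation J D α) {x : M}
    {Z W : Π x : M, TangentSpace 𝓘(ℝ, E) x} (hZ : IsSmoothNear Z x) (hW : IsSmoothNear W x) :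
    ContinuousAt (fun y => (inner ℝ (leviCivita (dualField α) y (Z y)) (W y) : ℝ)) x := by
  have hA := h.contMDiffAt_dualField x
  have e : (fun y => (inner ℝ (leviCivita (dualField α) y (Z y)) (W y) : ℝ)) =ᶠ[nhds x]
      fun y => lieDerivMetric (dualField α) Z W y / 2 := by
    filter_upwards [hZ.eventually_mdiffAt, hW.eventually_mdiffAt] with y h1 h2
    rw [lieDerivMetric_eq (h.mdiffAt_dualField y) h1 h2, ← h.nabla_symm]
    ring
  rw [continuousAt_congr e]
  have c1 : ContinuousAt (fun y => mvfderiv 𝓘(ℝ, E) (fun z => (inner ℝ (Z z) (W z) : ℝ)) y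
      (dualField α y)) x := (contMDiffAt_mvfderiv_apply (m := ∞) (n := ∞)
    (contMDiffAt_inner hZ.self_of_nhds hW.self_of_nhds) hA (by simp)).continuousAt
  have c2 := (contMDiffAt_inner (contMDiffAt_mlieBracket hA hZ.self_of_nhds)
    hW.self_of_nhds).continuousAt
  have c3 := (contMDiffAt_inner hZ.self_of_nhds
    (contMDiffAt_mlieBracket hA hW.self_of_nhds)).continuousAt
  exact ((c1.sub c2).sub c3).div_const 2

/-- The tensor `α ⊗ A + ∇ A`, where `A` is dual to `α`, commutes with `J`. -/
theorem smul_add_nabla_comm (h : IsHomotheticKahlerFoliation J D α)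
    (hdim : 2 < Module.finrank ℝ E) (x : M) (u : TangentSpace 𝓘(ℝ, E) x) :
    α x (J x u) • dualField α x + leviCivita (dualField α) x (J x u)
      = J x (α x u • dualField α x + leviCivita (dualField α) x u) := by
  obtain ⟨Z, hZ, rfl⟩ := exists_isSmoothNear x u
  refine ext_inner_right ℝ fun w => ?_
  obtain ⟨W, hW, rfl⟩ := exists_isSmoothNear x w
  have hJZ := h.kahler.isSmoothNear hZ
  have hJW := h.kahler.isSmoothNear hW
  have hA := h.contMDiffAt_dualField x
  let f : M → ℝ := fun y =>
    inner ℝ (dualField α y) (J y (Z y)) * inner ℝ (dualField α y) (W y)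
      + inner ℝ (leviCivita (dualField α) y (J y (Z y))) (W y)
      + (inner ℝ (dualField α y) (Z y) * inner ℝ (dualField α y) (J y (W y))
      + inner ℝ (leviCivita (dualField α) y (Z y)) (J y (W y)))
  have hf : ∀ y, (inner ℝ (α y (J y (Z y)) • dualField α y
      + leviCivita (dualField α) y (J y (Z y))) (W y) : ℝ)
      - inner ℝ (J y (α y (Z y) • dualField α y + leviCivita (dualField α) y (Z y))) (W y)
      = f y := fun y => by
    rw [h.kahler.inner_J_left, inner_add_left, inner_add_left, inner_smul_left, inner_smul_left,
      ← inner_dualField, ← inner_dualField]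
    simp only [f, conj_trivial]
    ring
  have hfc : ContinuousAt f x :=
    (((contMDiffAt_inner hA hJZ.self_of_nhds).continuousAt.mul
      (contMDiffAt_inner hA hW.self_of_nhds).continuousAt).add
      (h.continuousAt_inner_nabla hJZ hW)).add
    (((contMDiffAt_inner hA hZ.self_of_nhds).continuousAt.mul
      (contMDiffAt_inner hA hJW.self_of_nhds).continuousAt).add
      (h.continuousAt_inner_nabla hZ hJW))
  rw [← sub_eq_zero, hf x]
  by_contra hne
  -- If the defect `f` is nonzero at `x`, it is nonzero nearby, where `α` must then vanish. So `A`
  -- is zero near `x`, and with it `∇A` and `f` at `x`.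
  have hA0 : ∀ᶠ y in nhds x, dualField α y = 0 := by
    filter_upwards [hfc.eventually_ne hne] with y hy
    by_contra hy0
    exact hy (by rw [← hf y, h.smul_add_nabla_comm_of_ne_zero hdim (mt dualField_eq_zero_iff.2 hy0), sub_self])
  have hn := leviCivita_eq_zero_of_eventually (h.mdiffAt_dualField x) hA0
  exact hne (by simp only [f, hn, hA0.self_of_nhds, inner_zero_left, zero_mul, add_zero])

section Primitive

variable {V : Set M} {φ : M → ℝ}

theorem nabla_exp_smul (h : IsHomotheticKahlerFoliation J D α) {x : M} (hφ : MDiffAt φ x)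
    (hd : mvfderiv 𝓘(ℝ, E) φ x = α x) (u : TangentSpace 𝓘(ℝ, E) x) :
    leviCivita (fun y => Real.exp (φ y) • J y (dualField α y)) x u
      = Real.exp (φ x) • J x (α x u • dualField α x + leviCivita (dualField α) x u) := by
  have he : MDiffAt (fun y => Real.exp (φ y)) x :=
    ((Real.hasDerivAt_exp _).differentiableAt.mdifferentiableAt).comp x hφ
  rw [leviCivita_smul he (h.kahler.mdiffAt (h.mdiffAt_dualField x)), h.nabla_J_dualField,
    mvfderiv_real_comp (Real.hasDerivAt_exp _) hφ, hd, map_add, map_smul]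
  module

theorem isSmoothFieldOn_exp_smul (h : IsHomotheticKahlerFoliation J D α) (hφ : CMDiff[V] ∞ φ)
    (hV : IsOpen V) :
    IsSmoothFieldOn V (fun y => Real.exp (φ y) • J y (dualField α y)) := by
  intro x hx
  have h1 := hφ.contMDiffAt (hV.mem_nhds hx)
  have h2 : CMDiffAt ∞ (fun y => Real.exp (φ y)) x := Real.contDiff_exp.contMDiff.contMDiffAt.comp x h1
  exact (h2.smul_section (h.kahler.contMDiffAt (h.contMDiffAt_dualField x))).contMDiffWithinAt

/-- `J S` is skew because `S` is symmetric, `J` is skew and the two commute. -/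
theorem isKillingOn_exp_smul (h : IsHomotheticKahlerFoliation J D α)
    (hdim : 2 < Module.finrank ℝ E) (hV : IsOpen V) (hφ : CMDiff[V] ∞ φ)
    (hd : ∀ y ∈ V, mvfderiv 𝓘(ℝ, E) φ y = α y) :
    IsKillingOn V (fun y => Real.exp (φ y) • J y (dualField α y)) := by
  have hs := h.isSmoothFieldOn_exp_smul hφ hV
  refine ⟨hs, fun x hx Y Z hY hZ => ?_⟩
  have hXx := (hs.contMDiffAt (hV.mem_nhds hx)).mdifferentiableAt (by simp)
  have hφx := (hφ.contMDiffAt (hV.mem_nhds hx)).mdifferentiableAt (by simp)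
  have hL : (inner ℝ (α x (Y x) • dualField α x + leviCivita (dualField α) x (Y x)) (J x (Z x)) : ℝ)
      = inner ℝ (Y x) (α x (J x (Z x)) • dualField α x
        + leviCivita (dualField α) x (J x (Z x))) := by
    rw [inner_add_left, inner_add_right, inner_smul_left, inner_smul_right, h.nabla_symm,
      inner_dualField, real_inner_comm (dualField α x) (Y x), inner_dualField, conj_trivial]
    ring
  rw [lieDerivMetric_eq hXx hY hZ, h.nabla_exp_smul hφx (hd x hx), h.nabla_exp_smul hφx (hd x hx),
    inner_smul_left, inner_smul_right, h.kahler.inner_J_left, hL, h.smul_add_nabla_comm hdim,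
    conj_trivial]
  ring

theorem isHolomorphicOn_exp_smul (h : IsHomotheticKahlerFoliation J D α)
    (hdim : 2 < Module.finrank ℝ E) (hV : IsOpen V) (hφ : CMDiff[V] ∞ φ)
    (hd : ∀ y ∈ V, mvfderiv 𝓘(ℝ, E) φ y = α y) :
    IsHolomorphicOn J V (fun y => Real.exp (φ y) • J y (dualField α y)) := by
  have hs := h.isSmoothFieldOn_exp_smul hφ hV
  refine ⟨hs, fun x hx Y hY => ?_⟩
  have hXx := (hs.contMDiffAt (hV.mem_nhds hx)).mdifferentiableAt (by simp)
  have hφx := (hφ.contMDiffAt (hV.mem_nhds hx)).mdifferentiableAt (by simp)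
  rw [lieDerivJ_eq h.kahler hXx hY, h.nabla_exp_smul hφx (hd x hx),
    h.nabla_exp_smul hφx (hd x hx), h.smul_add_nabla_comm hdim, map_smul, sub_self]

theorem gradient_exp {x : M} (hφ : MDiffAt φ x) (hd : mvfderiv 𝓘(ℝ, E) φ x = α x) :
    gradient (fun y => Real.exp (φ y)) x = Real.exp (φ x) • dualField α x := by
  refine ext_inner_right ℝ fun w => ?_
  rw [gradient, inner_sharp, mvfderiv_real_comp (Real.hasDerivAt_exp _) hφ, hd, inner_smul_left,
    inner_dualField, conj_trivial]

end Primitive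

/-! ### The principal section -/

/-- Half of the logarithm of the squared length of the dual field. -/
noncomputable def logLength (α : Π x : M, TangentSpace 𝓘(ℝ, E) x →L[ℝ] ℝ) (x : M) : ℝ :=
  Real.log (inner ℝ (dualField α x) (dualField α x)) / 2

/-- The unit field in the direction of the dual field. -/
noncomputable def unitField (α : Π x : M, TangentSpace 𝓘(ℝ, E) x →L[ℝ] ℝ) (x : M) :
    TangentSpace 𝓘(ℝ, E) x :=
  Real.exp (-logLength α x) • dualField α x

theorem exp_logLength_sq {x : M} (hx : α x ≠ 0) :
    Real.exp (logLength α x) * Real.exp (logLength α x)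
      = inner ℝ (dualField α x) (dualField α x) := by
  have hN : 0 < (inner ℝ (dualField α x) (dualField α x) : ℝ) :=
    real_inner_self_pos.2 (mt dualField_eq_zero_iff.1 hx)
  rw [← Real.exp_add, logLength, add_halves, Real.exp_log hN]

theorem contMDiffAt_logLength (h : IsHomotheticKahlerFoliation J D α) {x : M} (hx : α x ≠ 0) :
    CMDiffAt ∞ (logLength α) x := by
  have hN : (inner ℝ (dualField α x) (dualField α x) : ℝ) ≠ 0 :=
    inner_self_ne_zero.2 (mt dualField_eq_zero_iff.1 hx)
  have h1 := contMDiffAt_inner (h.contMDiffAt_dualField x) (h.contMDiffAt_dualField x)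
  have h2 : ContDiffAt ℝ ∞ (fun t : ℝ => Real.log t / 2)
    (inner ℝ (dualField α x) (dualField α x) : ℝ) := (Real.contDiffAt_log.2 hN).div_const 2
  exact h2.contMDiffAt.comp x h1

theorem contMDiffAt_unitField (h : IsHomotheticKahlerFoliation J D α) {x : M} (hx : α x ≠ 0) :
    CMDiffAt ∞ (T% (unitField α)) x := by
  have h1 : CMDiffAt ∞ (fun y => Real.exp (-logLength α y)) x :=
    ContMDiffAt.comp x (g := fun t : ℝ => Real.exp (-t))
      (Real.contDiff_exp.comp contDiff_neg).contMDiff.contMDiffAt (h.contMDiffAt_logLength hx)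
  exact h1.smul_section (h.contMDiffAt_dualField x)

theorem mvfderiv_logLength (h : IsHomotheticKahlerFoliation J D α) {x : M} (hx : α x ≠ 0)
    (u : TangentSpace 𝓘(ℝ, E) x) :
    mvfderiv 𝓘(ℝ, E) (logLength α) x u
      = inner ℝ (leviCivita (dualField α) x u) (dualField α x)
        / inner ℝ (dualField α x) (dualField α x) := by
  have hN : (inner ℝ (dualField α x) (dualField α x) : ℝ) ≠ 0 :=
    inner_self_ne_zero.2 (mt dualField_eq_zero_iff.1 hx)
  have h1 := mvfderiv_real_comp (f := fun y => (inner ℝ (dualField α y) (dualField α y) : ℝ))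
    ((Real.hasDerivAt_log hN).div_const 2)
    (mdiffAt_inner (h.mdiffAt_dualField x) (h.mdiffAt_dualField x)) u
  rw [h.mvfderiv_inner_dualField] at h1
  refine h1.trans ?_
  field_simp

theorem nabla_unitField (h : IsHomotheticKahlerFoliation J D α) {x : M} (hx : α x ≠ 0)
    (u : TangentSpace 𝓘(ℝ, E) x) :
    leviCivita (unitField α) x u = Real.exp (-logLength α x) •
      (leviCivita (dualField α) x u - (inner ℝ (leviCivita (dualField α) x u) (dualField α x)
        / inner ℝ (dualField α x) (dualField α x) : ℝ) • dualField α x) := by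
  have hl := (h.contMDiffAt_logLength hx).mdifferentiableAt (by simp)
  have hρ : HasDerivAt (fun t : ℝ => Real.exp (-t)) (-Real.exp (-logLength α x))
      (logLength α x) := by
    simpa using (hasDerivAt_neg (logLength α x)).exp
  have he : MDiffAt (fun y => Real.exp (-logLength α y)) x :=
    MDifferentiableAt.comp x (g := fun t : ℝ => Real.exp (-t))
      hρ.differentiableAt.mdifferentiableAt hl
  have h1 := leviCivita_smul he (h.mdiffAt_dualField x) u
  rw [mvfderiv_real_comp hρ hl, h.mvfderiv_logLength hx] at h1
  refine h1.trans ?_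
  module

theorem inner_dualField_of_mem_orthogonal (h : IsHomotheticKahlerFoliation J D α) {x : M}
    {e : TangentSpace 𝓘(ℝ, E) x} (he : e ∈ (D x)ᗮ) : (inner ℝ e (dualField α x) : ℝ) = 0 :=
  (Submodule.mem_orthogonal' _ _).1 he _ (h.dualField_mem x)

theorem nabla_unitField_orthogonal (h : IsHomotheticKahlerFoliation J D α) {x : M} (hx : α x ≠ 0)
    {e : TangentSpace 𝓘(ℝ, E) x} (he : e ∈ (D x)ᗮ) :
    leviCivita (unitField α) x e = (Real.exp (-logLength α x) *
      (inner ℝ (dualField α x) (dualField α x) / 2) : ℝ) • e := by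
  rw [h.nabla_unitField hx, h.nabla_orthogonal hx he, inner_smul_left,
    h.inner_dualField_of_mem_orthogonal he]
  simp [smul_smul]

/-- On `Dᗮ ≠ 0` the derivative of `ξ = A/|A|` is the positive scalar `|A|/2`, so its trace is
positive, while that of `J∇ξ` is a sum of multiples of `⟪Je, e⟫ = 0`. -/
theorem isPrincipalSectionOn_unitField (h : IsHomotheticKahlerFoliation J D α)
    (hdim : 2 < Module.finrank ℝ E) {W : Set M} (hW : ∀ x ∈ W, α x ≠ 0) :
    IsPrincipalSectionOn J D W (unitField α) where
  isSection := ⟨fun x hx => (h.contMDiffAt_unitField (hW x hx)).contMDiffWithinAt,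
    fun x _ => Submodule.smul_mem _ _ (h.dualField_mem x)⟩
  unit x hx := by
    have h1 := exp_logLength_sq (hW x hx)
    have h2 : (inner ℝ (unitField α x) (unitField α x) : ℝ) = 1 := by
      rw [unitField, inner_smul_left, inner_smul_right, ← h1, conj_trivial, Real.exp_neg]
      field_simp
    rwa [real_inner_self_eq_norm_sq, pow_eq_one_iff_of_nonneg (norm_nonneg _) two_ne_zero] at h2
  div_J x hx := by
    have hm := (h.contMDiffAt_unitField (hW x hx)).mdifferentiableAt (by simp)
    refine Finset.sum_eq_zero fun i _ => ?_
    rw [h.kahler.parallel _ x hm, h.nabla_unitField_orthogonal (hW x hx) (Subtype.mem _), map_smul,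
      inner_smul_left, inner_J_self (h.kahler.sq x) (h.kahler.isometry x), mul_zero]
  div_pos x hx := by
    have hN : 0 < (inner ℝ (dualField α x) (dualField α x) : ℝ) :=
      real_inner_self_pos.2 (mt dualField_eq_zero_iff.1 (hW x hx))
    have : FiniteDimensional ℝ (TangentSpace 𝓘(ℝ, E) x) :=
      inferInstanceAs (FiniteDimensional ℝ E)
    have hpos : 0 < Module.finrank ℝ (D x)ᗮ := by
      obtain ⟨e, he, he0⟩ := h.exists_ne_zero_mem_orthogonal hdim x
      exact Module.finrank_pos_iff_exists_ne_zero.2 ⟨⟨e, he⟩, fun h0 => he0 (congrArg Subtype.val h0)⟩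
    refine Finset.sum_pos (fun i _ => ?_) ⟨⟨0, hpos⟩, Finset.mem_univ _⟩
    rw [h.nabla_unitField_orthogonal (hW x hx) (Subtype.mem _), inner_smul_left, conj_trivial,
      ← Submodule.coe_inner,
      real_inner_self_eq_norm_sq (stdOrthonormalBasis ℝ (D x)ᗮ i), OrthonormalBasis.norm_eq_one]
    positivity

/-- Both sides equal `(1 + a/|A|²) α(u)`: on the left `a` is the eigenvalue of `∇A` at `A`, through
`d log|A|`; on the right `a + |A|²` is the one at `JA`, giving `p* = -(a + |A|²)/|A|`. -/
theorem mvfderiv_add_logLength (h : IsHomotheticKahlerFoliation J D α)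
    (hdim : 2 < Module.finrank ℝ E) {x : M} (hx : α x ≠ 0) {φ : M → ℝ} (hφ : MDiffAt φ x)
    (hd : mvfderiv 𝓘(ℝ, E) φ x = α x) (u : TangentSpace 𝓘(ℝ, E) x) :
    mvfderiv 𝓘(ℝ, E) (fun y => φ y + logLength α y) x u
      = - inner ℝ (leviCivita (fun y => J y (unitField α y)) x (J x (unitField α x)))
          (unitField α x) * inner ℝ (unitField α x) u := by
  have hN : (inner ℝ (dualField α x) (dualField α x) : ℝ) ≠ 0 :=
    inner_self_ne_zero.2 (mt dualField_eq_zero_iff.1 hx)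
  obtain ⟨a, ha, hJa⟩ := h.nabla_diagonal hdim hx
  have hl := (h.contMDiffAt_logLength hx).mdifferentiableAt (by simp)
  have hm := (h.contMDiffAt_unitField hx).mdifferentiableAt (by simp)
  have h1 : mvfderiv 𝓘(ℝ, E) (fun y => φ y + logLength α y) x u
      = mvfderiv 𝓘(ℝ, E) φ x u + mvfderiv 𝓘(ℝ, E) (logLength α) x u :=
    congrArg (fun L : TangentSpace 𝓘(ℝ, E) x →L[ℝ] ℝ => L u) (mvfderiv_add hφ hl)
  have i0 := inner_J_self (h.kahler.sq x) (h.kahler.isometry x) (dualField α x)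
  have hq := exp_logLength_sq hx
  have k : leviCivita (dualField α) x (J x (unitField α x))
      = (Real.exp (-logLength α x) * (a + inner ℝ (dualField α x) (dualField α x)) : ℝ)
        • J x (dualField α x) := by
    rw [unitField, map_smul, map_smul, hJa, smul_smul]
  rw [h1, hd, h.mvfderiv_logLength hx, h.nabla_symm, ha, h.kahler.parallel _ x hm,
    h.nabla_unitField hx, k, inner_smul_left _ (dualField α x), i0, mul_zero, zero_div, zero_smul,
    sub_zero, unitField]
  simp only [inner_smul_left, inner_smul_right, map_smul, h.kahler.sq, conj_trivial,
    inner_neg_left, real_inner_comm (dualField α x) u, inner_dualField α x u, Real.exp_neg, ← hq]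
  field_simp
  ring

theorem isLocalSpecialKillingOn_exp_smul (h : IsHomotheticKahlerFoliation J D α)
    (hdim : 2 < Module.finrank ℝ E) {W : Set M} (hWo : IsOpen W) (hW : ∀ x ∈ W, α x ≠ 0)
    {φ : M → ℝ} (hφ : CMDiff[W] ∞ φ) (hd : ∀ y ∈ W, mvfderiv 𝓘(ℝ, E) φ y = α y) :
    IsLocalSpecialKillingOn J D W (fun y => Real.exp (φ y) • J y (dualField α y)) := by
  refine ⟨h.isKillingOn_exp_smul hdim hWo hφ hd, unitField α, fun y => φ y + logLength α y,
    h.isPrincipalSectionOn_unitField hdim hW, fun x hx => ?_, fun x hx u => ?_, fun x hx => ?_⟩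
  · exact (hφ x hx).add (h.contMDiffAt_logLength (hW x hx)).contMDiffWithinAt
  · exact h.mvfderiv_add_logLength hdim (hW x hx)
      ((hφ.contMDiffAt (hWo.mem_nhds hx)).mdifferentiableAt (by simp)) (hd x hx) u
  · rw [unitField, map_smul, smul_smul, Real.exp_add, mul_assoc, ← Real.exp_add, add_neg_cancel,
      Real.exp_zero, mul_one]

end IsHomotheticKahlerFoliation

end SpecialField

end HomotheticKahler

theorem lemma6p2
    {E : Type*} [NormedAddCommGroup E] [NormedSpace ℝ E] [FiniteDimensional ℝ E]
    (n : ℕ) (hn : 2 ≤ n) (hdim : Module.finrank ℝ E = 2 * n)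
    {M : Type*} [MetricSpace M] [CompleteSpace M] [ChartedSpace E M] [IsManifold 𝓘(ℝ, E) ∞ M]
    [RiemannianBundle (fun x : M => TangentSpace 𝓘(ℝ, E) x)]
    [IsContMDiffRiemannianBundle 𝓘(ℝ, E) ∞ E (fun x : M => TangentSpace 𝓘(ℝ, E) x)]
    [IsRiemannianManifold 𝓘(ℝ, E) M]
    (J : Π x : M, TangentSpace 𝓘(ℝ, E) x →L[ℝ] TangentSpace 𝓘(ℝ, E) x)
    (hJ : HomotheticKahler.IsKahler J)
    (D : Π x : M, Submodule ℝ (TangentSpace 𝓘(ℝ, E) x))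
    (hD : HomotheticKahler.IsComplexFoliation J D)
    (hDgeo : HomotheticKahler.IsTotallyGeodesic D)
    (hDhol : HomotheticKahler.IsHolomorphicFoliation J D)
    (α : Π x : M, TangentSpace 𝓘(ℝ, E) x →L[ℝ] ℝ)
    (hα : HomotheticKahler.IsHomotheticFoliation D α)
    (U K : Set M) (hU : U = {x : M | α x ≠ 0}) (hK : K = {x : M | α x = 0})
    (hUne : U.Nonempty)
    (V : Set M) (hVopen : IsOpen V) (hVconv : HomotheticKahler.IsGeodesicallyConvex V) :
    ∃ (X : Π x : M, TangentSpace 𝓘(ℝ, E) x) (τ : M → ℝ),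
      CMDiff[V] ∞ τ ∧
      (∀ x ∈ V, X x = J x (HomotheticKahler.gradient τ x)) ∧
      HomotheticKahler.IsKillingOn V X ∧
      HomotheticKahler.IsHolomorphicOn J V X ∧
      (∀ x ∈ V ∩ K, X x = 0) ∧
      ∀ W : Set M, IsOpen W → HomotheticKahler.IsGeodesicallyConvex W → W ⊆ V ∩ U →
        HomotheticKahler.IsLocalSpecialKillingOn J D W X := by
  have h : HomotheticKahler.IsHomotheticKahlerFoliation J D α := ⟨hJ, hD, hDgeo, hα⟩
  have hdim2 : 2 < Module.finrank ℝ E := by omega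
  subst hU hK
  obtain ⟨φ, hφ, hd⟩ : ∃ φ : M → ℝ, CMDiff[V] ∞ φ ∧
      ∀ y ∈ V, mvfderiv 𝓘(ℝ, E) φ y = α y := by
    -- The empty set counts as geodesically convex but is not contractible.
    rcases V.eq_empty_or_nonempty with rfl | hne
    · exact ⟨fun _ => 0, contMDiffOn_const, fun y hy => hy.elim⟩
    · have : LocallyCompactSpace M := Manifold.locallyCompact_of_finiteDimensional 𝓘(ℝ, E)
      have : ContractibleSpace V := hVconv.contractibleSpace hVopen hne
      exact HomotheticKahler.exists_primitive hα.smooth hα.closed hVopen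
  refine ⟨fun y => Real.exp (φ y) • J y (HomotheticKahler.dualField α y),
    fun y => Real.exp (φ y), ?_, fun x hx => ?_, h.isKillingOn_exp_smul hdim2 hVopen hφ hd,
    h.isHolomorphicOn_exp_smul hdim2 hVopen hφ hd, fun x hx => ?_, fun W hW _ hWV => ?_⟩
  · exact Real.contDiff_exp.contMDiff.comp_contMDiffOn hφ
  · rw [HomotheticKahler.IsHomotheticKahlerFoliation.gradient_exp
      ((hφ.contMDiffAt (hVopen.mem_nhds hx)).mdifferentiableAt (by simp)) (hd x hx), map_smul]
  · have h0 : HomotheticKahler.dualField α x = 0 :=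
      HomotheticKahler.dualField_eq_zero_iff.2 hx.2
    simp [h0]
  · exact h.isLocalSpecialKillingOn_exp_smul hdim2 hW (fun x hx => (hWV hx).2)
      (hφ.mono fun x hx => (hWV hx).1) fun y hy => hd y (hWV hy).1
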